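/- For integers $n\ge 1$, $p\ge 2$, let $J=(J_{i_1,\dots,i_p})_{1\le i_1,\dots,i_p\le n}$ have i.i.d. standard normal entries, and for $\sigma\in\Sigma_n=\{-1,1\}^n$ let $$H(\sigma)=n^{-\frac{p+1}{2}}\sum_{1\le i_1,\dots,i_p\le n}J_{i_1,\dots,i_p}\,\sigma_{i_1}\cdots\sigma_{i_p},\qquad \mathcal S(\epsilon)=\bigl\{\sigma\in\Sigma_n: H(\sigma)\ge(1-\epsilon)\sqrt{2\ln 2}\bigr\}.$$ Let $d_H$ be the Hamming distance. A set $A\subseteq\Sigma_n$ has the $(\nu_1,\nu_2)$-overlap gap property (OGP) if for all $\sigma,\sigma'\in A$ either $d_H(\sigma,\sigma')\le\nu_1n$ or $d_H(\sigma,\sigma')\ge\nu_2n$. A $(\nu_1,\nu_2)$-clustering of $A$ is a partition of $A$ into non-empty sets (clusters) such that $d_H(\sigma,\sigma')\le\nu_1n$ for $\sigma,\sigma'$ in the same cluster and $d_H(\sigma,\sigma')\ge\nu_2n$ for $\sigma,\sigma'$ in different clusters. **Theorem.** For every $0<\epsilon<1-\frac1{\sqrt2}$ there exist $\hat P\in\mathbb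 N$, $\nu_1,\nu_2$ with $0<\nu_1<\frac12\nu_2<\nu_2<1$, and $c_1>c_2>0$ such that the following holds for every fixed $p\ge\hat P$, both for $A=\mathcal S(\epsilon)$ and, for every $0<\epsilon'<\epsilon$, for $A=\mathcal S(\epsilon)\setminus\mathcal S(\epsilon')$. (a) With probability at least $1-e^{-\Theta(n)}$ as $n\to\infty$, $A$ has the $(\nu_1,\nu_2)$-OGP. (b) With probability at least $1-e^{-\Theta(n)}$ as $n\to\infty$, $|A|\ge 2^{c_1n}$, the set $A$ has a unique $(\nu_1,\nu_2)$-clustering $\mathcal C_1,\dots,\mathcal C_L$, and $\max_{1\le i\le L}|\mathcal C_i|\le 2^{c_2n}$; in particular $L\ge 2^{(c_1-c_2)n}$, so $L=2^{\Omega(n)}$. Here "with probability at least $1-e^{-\Theta(n)}$" means that for some constant $c>0$, which may depend on $p$, $\epsilon$, $\epsilon'$ and the constants above but not on $n$, the probability is at least $1-e^{-cn}$ for all sufficiently large $n$. -/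

import Mathlib

open MeasureTheory ProbabilityTheory Filter

namespace PSpin

/-- The discrete cube `{-1, 1}^n`; the units of `ℤ` are exactly `1` and `-1`. -/
abbrev Config (n : ℕ) : Type := Fin n → ℤˣ

/-- Order-`p` real tensors `(J_{i_1, …, i_p})` with indices in an `n`-element set. -/
abbrev Tensor (n p : ℕ) : Type := (Fin p → Fin n) → ℝ

/-- The law of an order-`p` tensor with i.i.d. standard normal entries. -/
noncomputable def disorder (n p : ℕ) : Measure (Tensor n p) :=
  Measure.pi fun _ => gaussianReal 0 1

/-- The pure `p`-spin Hamiltonian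
`H(σ) = n^{-(p+1)/2} ∑_{i_1, …, i_p} J_{i_1, …, i_p} σ_{i_1} ⋯ σ_{i_p}`. -/
noncomputable def hamiltonian {n p : ℕ} (J : Tensor n p) (σ : Config n) : ℝ :=
  (n : ℝ) ^ (-(((p : ℝ) + 1) / 2)) *
    ∑ i : Fin p → Fin n, J i * ∏ k : Fin p, ((σ (i k) : ℤ) : ℝ)

/-- The super-level set `S(ε) = {σ : H(σ) ≥ (1 - ε) √(2 ln 2)}`. -/
noncomputable def superLevel {n p : ℕ} (J : Tensor n p) (ε : ℝ) : Finset (Config n) :=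
  Finset.univ.filter fun σ => (1 - ε) * Real.sqrt (2 * Real.log 2) ≤ hamiltonian J σ

/-- The `(ν₁, ν₂)`-overlap gap property of a set of configurations. -/
def HasOGP {n : ℕ} (ν₁ ν₂ : ℝ) (A : Finset (Config n)) : Prop :=
  ∀ σ ∈ A, ∀ τ ∈ A,
    (hammingDist σ τ : ℝ) ≤ ν₁ * n ∨ ν₂ * n ≤ (hammingDist σ τ : ℝ)

/-- A partition of `A` into (non-empty) clusters is a `(ν₁, ν₂)`-clustering if each cluster has
diameter at most `ν₁ n` and distinct clusters are at distance at least `ν₂ n`. -/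
def IsClustering {n : ℕ} (ν₁ ν₂ : ℝ) {A : Finset (Config n)} (C : Finpartition A) : Prop :=
  (∀ c ∈ C.parts, ∀ σ ∈ c, ∀ τ ∈ c, (hammingDist σ τ : ℝ) ≤ ν₁ * n) ∧
    ∀ c ∈ C.parts, ∀ d ∈ C.parts, c ≠ d →
      ∀ σ ∈ c, ∀ τ ∈ d, ν₂ * n ≤ (hammingDist σ τ : ℝ)

/-- The events `E n` have probability at least `1 - e^{-Θ(n)}` as `n → ∞`, for fixed `p`. -/
def ExpLikely (p : ℕ) (E : (n : ℕ) → Set (Tensor n p)) : Prop :=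
  ∃ c : ℝ, 0 < c ∧ ∀ᶠ n : ℕ in atTop,
    1 - Real.exp (-c * n) ≤ (disorder n p).real (E n)

/-- The random set `A` breaks into exponentially many well-separated clusters:
with probability `1 - e^{-Θ(n)}` it has the `(ν₁, ν₂)`-overlap gap property; and with probability
`1 - e^{-Θ(n)}` it has at least `2^{c₁ n}` elements, it has exactly one `(ν₁, ν₂)`-clustering,
every cluster in this clustering has at most `2^{c₂ n}` elements, and there are at least
`2^{(c₁ - c₂) n}` clusters. -/
def Shatters (p : ℕ) (ν₁ ν₂ c₁ c₂ : ℝ)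
    (A : (n : ℕ) → Tensor n p → Finset (Config n)) : Prop :=
  ExpLikely p (fun n => {J | HasOGP ν₁ ν₂ (A n J)}) ∧
  ExpLikely p (fun n => {J |
    (2 : ℝ) ^ (c₁ * n) ≤ ((A n J).card : ℝ) ∧
    (∃! C : Finpartition (A n J), IsClustering ν₁ ν₂ C) ∧
    ∀ C : Finpartition (A n J), IsClustering ν₁ ν₂ C →
      (∀ c ∈ C.parts, (c.card : ℝ) ≤ (2 : ℝ) ^ (c₂ * n)) ∧
      (2 : ℝ) ^ ((c₁ - c₂) * n) ≤ (C.parts.card : ℝ)})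

end PSpin

/-!
The energies of two configurations with overlap `R` have correlation `R ^ p`, which is negligible
for large `p` unless `|R|` is close to `1`. So two given configurations with intermediate `R` are
both in `S(ε)` with probability about `exp (-(1 - ε)² 2 log 2 · n)`. Since `(1 - ε)² > 1 / 2`, this
beats the number of pairs whose overlap is at least some `r` close to `1`, namely `2 ^ n` times an
arbitrarily small exponential: a union bound over these pairs gives the overlap gap. Under the gap,
being at distance at most `ν₁ n` is an equivalence relation as soon as `ν₁ < ν₂ / 2`, its classes
are the only clustering, and each of them lies in a Hamming ball of small entropy.

It remains to bound `|S(ε)|` from below. For large `p` its second moment is at most `n + 3` times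
the square of its exponential first-moment scale, so the Paley–Zygmund inequality only gives
`|S(δ)| ≥ 2 ^ (c n)` with a subexponentially small probability. Gaussian concentration amplifies it:
for `δ < ε`, a tensor with `|S(δ)| ≥ 2 ^ (c n)` is at `ℓ¹` distance at least of order
`n ^ ((p + 1) / 2)` from every tensor with `|S(ε)| < 2 ^ (c n)`, so the product of the two
probabilities is exponentially small. Removing `S(δ)` from `S(ε)` costs little because, by the first
moment, `|S(δ)|` is exponentially smaller.
-/

namespace PSpin

section Concentration

variable {Ω Ω' : Type*} [MeasurableSpace Ω] [MeasurableSpace Ω'] {μ : Measure Ω} {ν : Measure Ω'}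
  {c c' : NNReal}

lemma integrable_cosh_mul_sub [SFinite μ] {U : Ω → ℝ}
    (hU : ∀ t, Integrable (fun x => Real.exp (t * U x)) μ) (t : ℝ) :
    Integrable (fun z : Ω × Ω => Real.cosh (t * (U z.1 - U z.2))) (μ.prod μ) := by
  refine ((((hU t).mul_prod (hU (-t))).add ((hU (-t)).mul_prod (hU t))).div_const 2).congr
    (ae_of_all _ fun z => ?_)
  simp only [Pi.add_apply, Real.cosh_eq, ← Real.exp_add]
  ring_nf

lemma mgf_mul_mgf_neg [SFinite μ] {U : Ω → ℝ}
    (hU : ∀ t, Integrable (fun x => Real.exp (t * U x)) μ) (t : ℝ) :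
    mgf U μ t * mgf U μ (-t) = ∫ z, Real.cosh (t * (U z.1 - U z.2)) ∂(μ.prod μ) := by
  have hcosh (z : Ω × Ω) : Real.cosh (t * (U z.1 - U z.2)) =
      (Real.exp (t * U z.1) * Real.exp (-t * U z.2) +
        Real.exp (-t * U z.1) * Real.exp (t * U z.2)) / 2 := by
    rw [Real.cosh_eq, ← Real.exp_add, ← Real.exp_add]
    ring_nf
  have hprod (s : ℝ) : ∫ z, Real.exp (s * U z.1) * Real.exp (-s * U z.2) ∂(μ.prod μ) =
      mgf U μ s * mgf U μ (-s) :=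
    integral_prod_mul (fun x => Real.exp (s * U x)) fun x => Real.exp (-s * U x)
  have hswap := hprod (-t)
  rw [neg_neg] at hswap
  simp_rw [hcosh]
  rw [integral_div, integral_add ((hU t).mul_prod (hU (-t))) ((hU (-t)).mul_prod (hU t)),
    hprod, hswap]
  ring

lemma mgf_mul_mgf_neg_le_of_abs_sub_le [SFinite μ] {X U : Ω → ℝ}
    (hU : ∀ t, Integrable (fun x => Real.exp (t * U x)) μ)
    (hX : ∀ t, Integrable (fun x => Real.exp (t * X x)) μ)
    (hUX : ∀ x y, |U x - U y| ≤ |X x - X y|) (t : ℝ) :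
    mgf U μ t * mgf U μ (-t) ≤ mgf X μ t * mgf X μ (-t) := by
  rw [mgf_mul_mgf_neg hU, mgf_mul_mgf_neg hX]
  refine integral_mono (integrable_cosh_mul_sub hU t) (integrable_cosh_mul_sub hX t) fun z => ?_
  rw [Real.cosh_le_cosh, abs_mul, abs_mul]
  exact mul_le_mul_of_nonneg_left (hUX _ _) (abs_nonneg t)

lemma integrable_exp_mul_of_abs_sub_le [IsProbabilityMeasure μ] {X U : Ω → ℝ}
    (hX : ∀ t, Integrable (fun x => Real.exp (t * X x)) μ) (hU : Measurable U)
    (hUX : ∀ x y, |U x - U y| ≤ |X x - X y|) (t : ℝ) :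
    Integrable (fun x => Real.exp (t * U x)) μ := by
  obtain ⟨x₀⟩ : Nonempty Ω := nonempty_of_isProbabilityMeasure μ
  have hbound : Integrable
      (fun x => Real.exp (|t| * (|U x₀| + |X x₀|)) * Real.exp (|t| * |X x|)) μ :=
    (integrable_exp_mul_abs (hX _) (hX _)).const_mul _
  refine hbound.mono' (by fun_prop) (ae_of_all _ fun x => ?_)
  have hUx : |U x| ≤ |U x₀| + |X x₀| + |X x| := by
    have := abs_sub_abs_le_abs_sub (U x) (U x₀)
    have := abs_sub (X x) (X x₀)
    linarith [hUX x x₀]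
  have htU : t * U x ≤ |t| * (|U x₀| + |X x₀| + |X x|) :=
    calc t * U x ≤ |t| * |U x| := by rw [← abs_mul]; exact le_abs_self _
      _ ≤ |t| * (|U x₀| + |X x₀| + |X x|) := by gcongr
  rw [Real.norm_eq_abs, Real.abs_exp, ← Real.exp_add, ← mul_add]
  exact Real.exp_le_exp.2 htU

lemma exp_mul_integral_le_mgf [IsProbabilityMeasure μ] {U : Ω → ℝ}
    (hU : Integrable U μ) {t : ℝ} (hexp : Integrable (fun x => Real.exp (t * U x)) μ) :
    Real.exp (t * ∫ x, U x ∂μ) ≤ mgf U μ t := by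
  rw [← integral_const_mul]
  exact convexOn_exp.map_integral_le Real.continuous_exp.continuousOn isClosed_univ
    (by simp) (hU.const_mul t) hexp

lemma hasSubgaussianMGF_sub_integral [IsProbabilityMeasure μ] {X U : Ω → ℝ}
    (hX : HasSubgaussianMGF X c μ) (hU : Measurable U)
    (hUX : ∀ x y, |U x - U y| ≤ |X x - X y|) :
    HasSubgaussianMGF (fun x => U x - ∫ y, U y ∂μ) (2 * c) μ := by
  have hexp := integrable_exp_mul_of_abs_sub_le hX.integrable_exp_mul hU hUX
  have hint : Integrable U μ := by
    simpa using integrable_pow_of_integrable_exp_mul one_ne_zero (hexp 1) (hexp (-1)) 1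
  have hfactor (t : ℝ) (x : Ω) : Real.exp (t * (U x - ∫ y, U y ∂μ)) =
      Real.exp (t * U x) * Real.exp (-t * ∫ y, U y ∂μ) := by
    rw [← Real.exp_add]
    ring_nf
  refine ⟨fun t => ?_, fun t => ?_⟩
  · simp_rw [hfactor]
    exact (hexp t).mul_const _
  calc mgf (fun x => U x - ∫ y, U y ∂μ) μ t
      = mgf U μ t * Real.exp (-t * ∫ y, U y ∂μ) := by simp_rw [mgf, hfactor, integral_mul_const]
    _ ≤ mgf U μ t * mgf U μ (-t) :=
        mul_le_mul_of_nonneg_left (exp_mul_integral_le_mgf hint (hexp (-t))) mgf_nonneg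
    _ ≤ mgf X μ t * mgf X μ (-t) :=
        mgf_mul_mgf_neg_le_of_abs_sub_le hexp hX.integrable_exp_mul hUX t
    _ ≤ Real.exp (c * t ^ 2 / 2) * Real.exp (c * (-t) ^ 2 / 2) :=
        mul_le_mul (hX.mgf_le t) (hX.mgf_le (-t)) mgf_nonneg (Real.exp_pos _).le
    _ = Real.exp ((2 * c : NNReal) * t ^ 2 / 2) := by
        rw [← Real.exp_add]
        push_cast
        ring_nf

lemma hasSubgaussianMGF_prod [SFinite μ] [SFinite ν] {F : Ω × Ω' → ℝ} {G : Ω → ℝ}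
    (hF : Measurable F) (hG : HasSubgaussianMGF G c μ)
    (hFG : ∀ x, HasSubgaussianMGF (fun y => F (x, y) - G x) c' ν) :
    HasSubgaussianMGF F (c + c') (μ.prod ν) := by
  have hsplit (t : ℝ) (x : Ω) (y : Ω') : Real.exp (t * F (x, y)) =
      Real.exp (t * G x) * Real.exp (t * (F (x, y) - G x)) := by
    rw [← Real.exp_add]
    ring_nf
  have hsection (t : ℝ) (x : Ω) : ∫ y, Real.exp (t * F (x, y)) ∂ν ≤
      Real.exp (t * G x) * Real.exp (c' * t ^ 2 / 2) := by
    simp_rw [hsplit, integral_const_mul]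
    gcongr
    exact (hFG x).mgf_le t
  have hint (t : ℝ) : Integrable (fun z => Real.exp (t * F z)) (μ.prod ν) := by
    have hexpF : StronglyMeasurable fun z => Real.exp (t * F z) := by fun_prop
    refine (integrable_prod_iff hexpF.aestronglyMeasurable).2 ⟨ae_of_all _ fun x => ?_, ?_⟩
    · simp_rw [hsplit]
      exact ((hFG x).integrable_exp_mul t).const_mul _
    · simp only [Real.norm_eq_abs, Real.abs_exp]
      refine ((hG.integrable_exp_mul t).mul_const (Real.exp (c' * t ^ 2 / 2))).mono'
        hexpF.integral_prod_right'.aestronglyMeasurable (ae_of_all _ fun x => ?_)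
      rw [Real.norm_of_nonneg (integral_nonneg fun y => (Real.exp_pos _).le)]
      exact hsection t x
  refine ⟨hint, fun t => ?_⟩
  calc mgf F (μ.prod ν) t = ∫ x, ∫ y, Real.exp (t * F (x, y)) ∂ν ∂μ := integral_prod _ (hint t)
    _ ≤ ∫ x, Real.exp (t * G x) * Real.exp (c' * t ^ 2 / 2) ∂μ :=
        integral_mono (hint t).integral_prod_left ((hG.integrable_exp_mul t).mul_const _)
          (hsection t)
    _ ≤ Real.exp (c * t ^ 2 / 2) * Real.exp (c' * t ^ 2 / 2) := by
        rw [integral_mul_const]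
        gcongr
        exact hG.mgf_le t
    _ = Real.exp ((c + c' : NNReal) * t ^ 2 / 2) := by
        rw [← Real.exp_add]
        push_cast
        ring_nf

lemma exists_hasSubgaussianMGF_sub_prod {ν : Measure ℝ} [IsProbabilityMeasure μ]
    [IsProbabilityMeasure ν] {D : Ω → Ω → ℝ} (hD : ∀ x, D x x = 0)
    (hμ : ∀ G : Ω → ℝ, Measurable G → (∀ x x', |G x - G x'| ≤ D x x') →
      ∃ m, HasSubgaussianMGF (fun x => G x - m) c μ)
    (hν : HasSubgaussianMGF id c' ν) {F : Ω × ℝ → ℝ} (hF : Measurable F)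
    (hFD : ∀ z z', |F z - F z'| ≤ D z.1 z'.1 + |z.2 - z'.2|) :
    ∃ m, HasSubgaussianMGF (fun z => F z - m) (c + 2 * c') (μ.prod ν) := by
  let G : Ω → ℝ := fun x => ∫ y, F (x, y) ∂ν
  have hsection (x : Ω) : HasSubgaussianMGF (fun y => F (x, y) - G x) (2 * c') ν :=
    hasSubgaussianMGF_sub_integral hν (by fun_prop) fun y y' => by
      simpa [hD] using hFD (x, y) (x, y')
  have hint (x : Ω) : Integrable (fun y => F (x, y)) ν :=
    ((hsection x).integrable.add (integrable_const (G x))).congr (ae_of_all _ fun y => by simp)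
  have hGD (x x' : Ω) : |G x - G x'| ≤ D x x' := by
    have hdiff (y : ℝ) : ‖F (x, y) - F (x', y)‖ ≤ D x x' := by simpa using hFD (x, y) (x', y)
    rw [← integral_sub (hint x) (hint x')]
    simpa using norm_integral_le_of_norm_le_const (ae_of_all ν hdiff)
  obtain ⟨m, hm⟩ := hμ G hF.stronglyMeasurable.integral_prod_right'.measurable hGD
  refine ⟨m, hasSubgaussianMGF_prod (hF.sub_const m) hm fun x => ?_⟩
  simpa using hsection x

lemma hasSubgaussianMGF_of_comp_measurePreserving {e : Ω → Ω'} (he : MeasurePreserving e μ ν)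
    {U : Ω' → ℝ} (hU : Measurable U) (h : HasSubgaussianMGF (U ∘ e) c μ) :
    HasSubgaussianMGF U c ν := by
  have hU' := hU.comp he.measurable
  have hid := (HasSubgaussianMGF.id_map_iff hU'.aemeasurable).2 h
  rw [← Measure.map_map hU he.measurable, he.map_eq] at hid
  exact (HasSubgaussianMGF.id_map_iff hU.aemeasurable).1 hid

lemma exists_hasSubgaussianMGF_sub_pi {ν : Measure ℝ} [IsProbabilityMeasure ν]
    (hν : HasSubgaussianMGF id c ν) (ι : Type*) [Fintype ι] :
    ∀ F : (ι → ℝ) → ℝ, Measurable F → (∀ x y, |F x - F y| ≤ ∑ i, |x i - y i|) →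
      ∃ m, HasSubgaussianMGF (fun x => F x - m) (2 * Fintype.card ι * c)
        (Measure.pi fun _ => ν) := by
  refine Fintype.induction_empty_option (P := fun ι _ =>
    ∀ F : (ι → ℝ) → ℝ, Measurable F → (∀ x y, |F x - F y| ≤ ∑ i, |x i - y i|) →
      ∃ m, HasSubgaussianMGF (fun x => F x - m) (2 * Fintype.card ι * c)
        (Measure.pi fun _ => ν)) ?of_equiv ?empty ?option ι
  case of_equiv =>
    intro ι κ _ e ih F hF hFL
    let : Fintype ι := .ofEquiv κ e.symm
    have he := measurePreserving_piCongrLeft (fun _ : κ => ν) e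
    have hcoord (x : ι → ℝ) (i : ι) :
        MeasurableEquiv.piCongrLeft (fun _ : κ => ℝ) e x (e i) = x i :=
      Equiv.piCongrLeft_apply_apply (fun _ : κ => ℝ) e x i
    obtain ⟨m, hm⟩ := ih _ (hF.comp he.measurable) fun x y => (hFL _ _).trans_eq <| by
      simp [← e.sum_comp, hcoord]
    rw [Fintype.card_congr e] at hm
    exact ⟨m, hasSubgaussianMGF_of_comp_measurePreserving he (hF.sub_const m) hm⟩
  case empty =>
    intro F _ _
    refine ⟨F 0, ?_⟩
    have hzero (x : PEmpty → ℝ) : F x - F 0 = 0 := by rw [Subsingleton.elim x 0, sub_self]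
    simp only [hzero, Fintype.card_pempty, Nat.cast_zero, mul_zero, zero_mul]
    exact .fun_zero
  case option =>
    intro ι _ ih F hF hFL
    have he : MeasurePreserving (MeasurableEquiv.piOptionEquivProd fun _ : Option ι => ℝ).symm
        ((Measure.pi fun _ => ν).prod ν) (Measure.pi fun _ => ν) :=
      ⟨MeasurableEquiv.measurable _, Measure.pi_map_piOptionEquivProd fun _ => ν⟩
    obtain ⟨m, hm⟩ := exists_hasSubgaussianMGF_sub_prod (D := fun x y => ∑ i, |x i - y i|)
      (by simp) ih hν (hF.comp he.measurable) fun z z' => (hFL _ _).trans_eq <| by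
        rw [Fintype.sum_option, add_comm]
        rfl
    refine ⟨m, hasSubgaussianMGF_of_comp_measurePreserving he (hF.sub_const m) ?_⟩
    have hcard : (2 * Fintype.card (Option ι) * c : NNReal) = 2 * Fintype.card ι * c + 2 * c := by
      rw [Fintype.card_option]
      push_cast
      ring
    rwa [hcard]

lemma measureReal_le_mul_measureReal_ge_le {X : Ω → ℝ} [IsProbabilityMeasure μ] {m a b : ℝ}
    (hX : HasSubgaussianMGF (fun x => X x - m) c μ) (hab : a ≤ b) :
    μ.real {x | X x ≤ a} * μ.real {x | b ≤ X x} ≤ Real.exp (-(b - a) ^ 2 / (4 * c)) := by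
  set t : ℝ := (b - a) / (2 * c)
  have ht : 0 ≤ t := div_nonneg (sub_nonneg.2 hab) (by positivity)
  have hge := measure_ge_le_exp_mul_mgf (b - m) ht (hX.integrable_exp_mul t)
  have hle := measure_le_le_exp_mul_mgf (a - m) (neg_nonpos.2 ht) (hX.integrable_exp_mul (-t))
  simp only [sub_le_sub_iff_right] at hge hle
  calc _ ≤ (Real.exp (- -t * (a - m)) * Real.exp (c * (-t) ^ 2 / 2)) *
        (Real.exp (-t * (b - m)) * Real.exp (c * t ^ 2 / 2)) := by
        gcongr
        · exact hle.trans (by gcongr; exact hX.mgf_le _)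
        · exact hge.trans (by gcongr; exact hX.mgf_le _)
    _ = Real.exp (c * t ^ 2 - t * (b - a)) := by
        simp only [← Real.exp_add]
        ring_nf
    _ = Real.exp (-(b - a) ^ 2 / (4 * c)) := by
        rcases eq_or_ne c 0 with rfl | hc
        · simp [t]
        · congr 1
          simp only [t]
          field_simp
          ring

lemma measureReal_mul_measureReal_le_of_separated {ν : Measure ℝ} [IsProbabilityMeasure ν]
    (hν : HasSubgaussianMGF id c ν) {ι : Type*} [Fintype ι] {A B : Set (ι → ℝ)} {d : ℝ}
    (hd : 0 ≤ d) (hAB : ∀ x ∈ A, ∀ y ∈ B, d ≤ ∑ i, |x i - y i|) :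
    (Measure.pi fun _ => ν).real A * (Measure.pi fun _ => ν).real B ≤
      Real.exp (-d ^ 2 / (8 * Fintype.card ι * c)) := by
  rcases B.eq_empty_or_nonempty with rfl | hB
  · simpa using (Real.exp_pos _).le
  let s : Set (PiLp 1 fun _ : ι => ℝ) := WithLp.ofLp ⁻¹' B
  have hs : s.Nonempty := hB.preimage (WithLp.ofLp_surjective 1)
  let F : (ι → ℝ) → ℝ := fun x => Metric.infDist (WithLp.toLp 1 x) s
  have hdist (x y : ι → ℝ) : dist (WithLp.toLp 1 x) (WithLp.toLp 1 y) = ∑ i, |x i - y i| := by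
    simp [PiLp.dist_eq_of_L1, Real.dist_eq]
  have hF : Measurable F := by fun_prop
  obtain ⟨m, hm⟩ := exists_hasSubgaussianMGF_sub_pi hν ι F hF fun x y => by
    rw [← hdist, ← Real.dist_eq]
    exact (Metric.lipschitz_infDist_pt s).dist_le_mul _ _ |>.trans_eq (by simp)
  have hA' : A ⊆ {x | d ≤ F x} := fun x hx => (Metric.le_infDist hs).2 fun y hy => by
    simpa [← hdist] using hAB x hx y.ofLp hy
  have hB' : B ⊆ {x | F x ≤ 0} := fun x hx => by
    exact (Metric.infDist_zero_of_mem (s := s) (x := WithLp.toLp 1 x) hx).le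
  calc (Measure.pi fun _ => ν).real A * (Measure.pi fun _ => ν).real B
      ≤ (Measure.pi fun _ => ν).real {x | d ≤ F x} *
          (Measure.pi fun _ => ν).real {x | F x ≤ 0} :=
        mul_le_mul (measureReal_mono hA') (measureReal_mono hB') measureReal_nonneg
          measureReal_nonneg
    _ ≤ Real.exp (-(d - 0) ^ 2 / (4 * (2 * Fintype.card ι * c : NNReal))) := by
        rw [mul_comm]
        exact measureReal_le_mul_measureReal_ge_le hm hd
    _ = Real.exp (-d ^ 2 / (8 * Fintype.card ι * c)) := by
        push_cast
        ring_nf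

end Concentration

section GaussianTails

lemma hasSubgaussianMGF_id_gaussianReal {v c : NNReal} (hvc : v ≤ c) :
    HasSubgaussianMGF id c (gaussianReal 0 v) :=
  ⟨integrable_exp_mul_gaussianReal, fun t => by
    simp only [mgf_id_gaussianReal, zero_mul, zero_add]
    gcongr⟩

lemma le_measureReal_gaussianReal_Ici {v : NNReal} (hv : v ≠ 0) {a h : ℝ} (ha : 0 ≤ a)
    (hh : 0 ≤ h) :
    h * ((√(2 * Real.pi * v))⁻¹ * Real.exp (-(a + h) ^ 2 / (2 * v))) ≤
      (gaussianReal 0 v).real (Set.Ici a) := by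
  calc h * ((√(2 * Real.pi * v))⁻¹ * Real.exp (-(a + h) ^ 2 / (2 * v)))
      = ∫ _ in Set.Icc a (a + h), (√(2 * Real.pi * v))⁻¹ * Real.exp (-(a + h) ^ 2 / (2 * v)) := by
        simp [hh]
    _ ≤ ∫ x in Set.Icc a (a + h), gaussianPDFReal 0 v x := by
        refine setIntegral_mono_on (integrableOn_const (by simp))
          (integrable_gaussianPDFReal 0 v).integrableOn measurableSet_Icc fun x hx => ?_
        have hx0 : 0 ≤ x := ha.trans hx.1
        simp only [gaussianPDFReal_def, sub_zero]
        gcongr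
        exact hx.2
    _ = (gaussianReal 0 v).real (Set.Icc a (a + h)) := by
        rw [measureReal_def, gaussianReal_apply_eq_integral 0 hv,
          ENNReal.toReal_ofReal (integral_nonneg fun x => gaussianPDFReal_nonneg _ _ _)]
    _ ≤ (gaussianReal 0 v).real (Set.Ici a) := measureReal_mono Set.Icc_subset_Ici_self

lemma map_sum_mul_pi_gaussianReal {ι : Type*} [Fintype ι] (w : ι → ℝ) :
    (Measure.pi fun _ : ι => gaussianReal 0 1).map (fun x => ∑ i, w i * x i) =
      gaussianReal 0 (∑ i, w i ^ 2).toNNReal := by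
  have hterm (i : ι) : HasLaw (fun y => w i * y) (gaussianReal 0 (w i ^ 2).toNNReal)
      (gaussianReal 0 1) := by
    simpa [Real.toNNReal_of_nonneg (sq_nonneg (w i))] using
      gaussianReal_const_mul (HasLaw.id (μ := gaussianReal 0 1)) (w i)
  have hcoord (i : ι) : HasLaw (fun x : ι → ℝ => w i * x i) (gaussianReal 0 (w i ^ 2).toNNReal)
      (Measure.pi fun _ : ι => gaussianReal 0 1) :=
    (hterm i).comp (measurePreserving_eval (fun _ : ι => gaussianReal 0 1) i).hasLaw
  have hmean : ∫ x, ∑ i, w i * x i ∂(Measure.pi fun _ : ι => gaussianReal 0 1) = 0 := by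
    rw [integral_finsetSum _ fun i _ => (hcoord i).hasGaussianLaw.integrable]
    exact Finset.sum_eq_zero fun i _ => by simpa using (hcoord i).integral_eq
  have hvar : Var[fun x => ∑ i, w i * x i; Measure.pi fun _ : ι => gaussianReal 0 1] =
      ∑ i, w i ^ 2 := by
    have h := variance_sum_pi fun i => (hterm i).hasGaussianLaw.memLp_two
    simp only [(hterm _).variance_eq, variance_id_gaussianReal] at h
    simpa [Finset.sum_fn, sq_nonneg] using h
  have hlaw := iIndepFun.hasGaussianLaw_fun_sum (fun i => (hcoord i).hasGaussianLaw)
    (iIndepFun_pi fun i => (hterm i).aemeasurable)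
  refine hlaw.map_eq_gaussianReal.trans ?_
  congr 1
  exact congrArg Real.toNNReal hvar

lemma measureReal_le_sum_mul_le {ι : Type*} [Fintype ι] {w : ι → ℝ} {v t : ℝ}
    (hw : ∑ i, w i ^ 2 ≤ v) (ht : 0 ≤ t) :
    (Measure.pi fun _ : ι => gaussianReal 0 1).real {x | t ≤ ∑ i, w i * x i} ≤
      Real.exp (-t ^ 2 / (2 * v)) := by
  have hv : 0 ≤ v := (Finset.sum_nonneg fun i _ => sq_nonneg (w i)).trans hw
  have hsubG := hasSubgaussianMGF_id_gaussianReal (Real.toNNReal_mono hw)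
  have hmeas : Measurable fun x : ι → ℝ => ∑ i, w i * x i := by fun_prop
  rw [← map_sum_mul_pi_gaussianReal] at hsubG
  calc (Measure.pi fun _ : ι => gaussianReal 0 1).real {x | t ≤ ∑ i, w i * x i}
      = ((Measure.pi fun _ : ι => gaussianReal 0 1).map fun x => ∑ i, w i * x i).real
          {y | t ≤ y} := (map_measureReal_apply hmeas measurableSet_Ici).symm
    _ ≤ Real.exp (-t ^ 2 / (2 * v)) := by
      simpa [hv] using hsubG.measure_ge_le ht

end GaussianTails

section Hamiltonian

variable {n p : ℕ}

instance : IsProbabilityMeasure (disorder n p) := by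
  unfold disorder
  infer_instance

/-- The normalised overlap `n⁻¹ ∑ⱼ σⱼ τⱼ ∈ [-1, 1]` of two configurations. -/
noncomputable def overlap (σ τ : Config n) : ℝ :=
  (∑ j, ((σ j : ℤ) : ℝ) * ((τ j : ℤ) : ℝ)) / n

/-- The tensor power of `σ`, normalised so that `hamiltonian J σ` is its inner product with `J`. -/
noncomputable def spinTensor (p : ℕ) (σ : Config n) : Tensor n p :=
  fun i => (n : ℝ) ^ (-(((p : ℝ) + 1) / 2)) * ∏ k, ((σ (i k) : ℤ) : ℝ)

lemma natCast_mul_overlap (σ τ : Config n) : n * overlap σ τ = n - 2 * hammingDist σ τ := by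
  have hspin (u v : ℤˣ) : ((u : ℤ) : ℝ) * ((v : ℤ) : ℝ) = 1 - 2 * if u ≠ v then 1 else 0 := by
    rcases Int.units_eq_one_or u with rfl | rfl <;> rcases Int.units_eq_one_or v with rfl | rfl <;>
      norm_num
  rcases eq_or_ne n 0 with rfl | hn
  · simp [hammingDist]
  · rw [overlap, mul_div_cancel₀ _ (Nat.cast_ne_zero.2 hn)]
    simp only [hspin, Finset.sum_sub_distrib, ← Finset.mul_sum, Finset.sum_boole, hammingDist]
    simp

lemma overlap_self (hn : n ≠ 0) (σ : Config n) : overlap σ σ = 1 := by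
  have h := natCast_mul_overlap σ σ
  rw [hammingDist_self, Nat.cast_zero, mul_zero, sub_zero] at h
  exact (mul_eq_left₀ (Nat.cast_ne_zero.2 hn)).1 h

lemma abs_overlap_le_one (σ τ : Config n) : |overlap σ τ| ≤ 1 := by
  rcases eq_or_ne n 0 with rfl | hn
  · simp [overlap]
  have hn' : (0 : ℝ) < n := by positivity
  have hdist : (hammingDist σ τ : ℝ) ≤ n := by
    exact_mod_cast hammingDist_le_card_fintype.trans_eq (Fintype.card_fin n)
  have hmul := natCast_mul_overlap σ τ
  rw [abs_le]
  constructor <;> nlinarith [(hammingDist σ τ).cast_nonneg (α := ℝ)]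

lemma hamiltonian_eq_sum_spinTensor (J : Tensor n p) (σ : Config n) :
    hamiltonian J σ = ∑ i, spinTensor p σ i * J i := by
  rw [hamiltonian, Finset.mul_sum]
  exact Finset.sum_congr rfl fun i _ => by rw [spinTensor]; ring

lemma measurable_hamiltonian (σ : Config n) : Measurable fun J : Tensor n p => hamiltonian J σ := by
  unfold hamiltonian
  fun_prop

lemma sum_spinTensor_mul_spinTensor (hn : n ≠ 0) (σ τ : Config n) :
    ∑ i, spinTensor p σ i * spinTensor p τ i = overlap σ τ ^ p / n := by
  have hn' : (0 : ℝ) < n := by positivity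
  have hscale : (n : ℝ) ^ (-(((p : ℝ) + 1) / 2)) * (n : ℝ) ^ (-(((p : ℝ) + 1) / 2)) =
      ((n : ℝ) ^ p * n)⁻¹ := by
    rw [← Real.rpow_add hn', ← pow_succ, ← Real.rpow_natCast, ← Real.rpow_neg hn'.le]
    push_cast
    ring_nf
  calc ∑ i, spinTensor p σ i * spinTensor p τ i
      = ((n : ℝ) ^ p * n)⁻¹ *
          ∑ i : Fin p → Fin n, ∏ k, ((σ (i k) : ℤ) : ℝ) * ((τ (i k) : ℤ) : ℝ) := by
        rw [← hscale, Finset.mul_sum]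
        exact Finset.sum_congr rfl fun i _ => by
          rw [spinTensor, spinTensor, Finset.prod_mul_distrib]; ring
    _ = overlap σ τ ^ p / n := by
        rw [← Fintype.sum_pow fun j => ((σ j : ℤ) : ℝ) * ((τ j : ℤ) : ℝ), overlap, div_pow]
        field_simp

lemma sum_spinTensor_sq (hn : n ≠ 0) (σ : Config n) :
    ∑ i, spinTensor p σ i ^ 2 = (n : ℝ)⁻¹ := by
  simp only [sq, sum_spinTensor_mul_spinTensor hn, overlap_self hn, one_pow, one_div]

lemma map_hamiltonian (hn : n ≠ 0) (σ : Config n) :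
    (disorder n p).map (fun J => hamiltonian J σ) = gaussianReal 0 (n : NNReal)⁻¹ := by
  simp only [hamiltonian_eq_sum_spinTensor, disorder, map_sum_mul_pi_gaussianReal,
    sum_spinTensor_sq hn]
  congr 1
  ext
  simp

lemma measureReal_le_hamiltonian_le (hn : n ≠ 0) {a : ℝ} (ha : 0 ≤ a) (σ : Config n) :
    (disorder n p).real {J | a ≤ hamiltonian J σ} ≤ Real.exp (-(a ^ 2 / 2 * n)) := by
  simp only [hamiltonian_eq_sum_spinTensor]
  refine (measureReal_le_sum_mul_le (sum_spinTensor_sq hn σ).le ha).trans_eq ?_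
  congr 1
  field_simp

lemma measureReal_le_hamiltonian_and_le (hn : n ≠ 0) {a : ℝ} (ha : 0 ≤ a) (σ τ : Config n) :
    (disorder n p).real {J | a ≤ hamiltonian J σ ∧ a ≤ hamiltonian J τ} ≤
      Real.exp (-(a ^ 2 / (1 + |overlap σ τ| ^ p) * n)) := by
  have hpow : overlap σ τ ^ p ≤ |overlap σ τ| ^ p := (le_abs_self _).trans_eq (abs_pow _ _)
  have hnorm : ∑ i, (spinTensor p σ i + spinTensor p τ i) ^ 2 ≤
      2 / n * (1 + |overlap σ τ| ^ p) := by
    calc ∑ i, (spinTensor p σ i + spinTensor p τ i) ^ 2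
        = 2 / n * (1 + overlap σ τ ^ p) := by
          simp only [add_sq, mul_assoc, Finset.sum_add_distrib, ← Finset.mul_sum,
            sum_spinTensor_sq hn, sum_spinTensor_mul_spinTensor hn]
          ring
      _ ≤ 2 / n * (1 + |overlap σ τ| ^ p) := by gcongr
  refine (measureReal_mono fun J hJ => ?_).trans
    ((measureReal_le_sum_mul_le hnorm (t := 2 * a) (by positivity)).trans_eq ?_)
  · simp only [Set.mem_ofPred_eq, hamiltonian_eq_sum_spinTensor] at hJ ⊢
    simp only [add_mul, Finset.sum_add_distrib]
    linarith [hJ.1, hJ.2]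
  · congr 1
    field_simp

lemma eventually_exp_le_measureReal_le_hamiltonian (p : ℕ) {a θ : ℝ} (ha : 0 ≤ a) (hθ : 0 < θ) :
    ∀ᶠ n : ℕ in atTop, ∀ σ : Config n,
      Real.exp (-((a ^ 2 / 2 + θ) * n)) ≤ (disorder n p).real {J | a ≤ hamiltonian J σ} := by
  set h := √(a ^ 2 + 2 * θ) - a
  have hh : 0 < h := sub_pos.2 (Real.lt_sqrt_of_sq_lt (by linarith))
  have hsq : (a + h) ^ 2 = a ^ 2 + 2 * θ := by
    rw [add_sub_cancel]
    exact Real.sq_sqrt (by positivity)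
  have hlim : Tendsto (fun n : ℕ => √(2 * Real.pi * (n : ℝ)⁻¹)) atTop (nhds 0) := by
    simpa using ((tendsto_inv_atTop_nhds_zero_nat (𝕜 := ℝ)).const_mul (2 * Real.pi)).sqrt
  filter_upwards [hlim.eventually_le_const hh, eventually_ne_atTop 0] with n hsmall hn σ
  have hpos : 0 < √(2 * Real.pi * (n : ℝ)⁻¹) := by positivity
  have htail := le_measureReal_gaussianReal_Ici (v := (n : NNReal)⁻¹) (by positivity) ha hh.le
  rw [← map_hamiltonian (p := p) hn σ,
    map_measureReal_apply (measurable_hamiltonian σ) measurableSet_Ici] at htail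
  calc Real.exp (-((a ^ 2 / 2 + θ) * n))
      ≤ h * (√(2 * Real.pi * (n : ℝ)⁻¹))⁻¹ * Real.exp (-((a ^ 2 / 2 + θ) * n)) := by
        refine le_mul_of_one_le_left (Real.exp_pos _).le ?_
        rwa [← div_eq_mul_inv, one_le_div hpos]
    _ = h * ((√(2 * Real.pi * (n : ℝ)⁻¹))⁻¹ * Real.exp (-(a + h) ^ 2 / (2 * (n : ℝ)⁻¹))) := by
        rw [hsq, mul_assoc]
        congr 3
        field_simp
    _ ≤ _ := by exact_mod_cast htail

end Hamiltonian

section OverlapCounting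

variable {n p : ℕ}

/-- The configurations whose overlap with `σ` has modulus at least `r`: for `r` close to `1`, the
union of a small Hamming ball around `σ` and its antipode. -/
noncomputable def cap (r : ℝ) (σ : Config n) : Finset (Config n) :=
  Finset.univ.filter fun τ => r ≤ |overlap σ τ|

lemma sum_exp_mul_overlap (l : ℝ) (σ : Config n) :
    ∑ τ, Real.exp (l * (n * overlap σ τ)) = (2 * Real.cosh l) ^ n := by
  have hoverlap (τ : Config n) : n * overlap σ τ = ∑ j, ((σ j : ℤ) : ℝ) * ((τ j : ℤ) : ℝ) := by
    rcases eq_or_ne n 0 with rfl | hn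
    · simp
    · rw [overlap, mul_div_cancel₀ _ (Nat.cast_ne_zero.2 hn)]
  have hsite (u : ℤˣ) : ∑ v : ℤˣ, Real.exp (l * (((u : ℤ) : ℝ) * ((v : ℤ) : ℝ))) =
      2 * Real.cosh l := by
    rw [UnitsInt.univ, Finset.sum_pair (by decide), Real.cosh_eq]
    rcases Int.units_eq_one_or u with rfl | rfl <;> simp <;> ring
  calc ∑ τ, Real.exp (l * (n * overlap σ τ))
      = ∑ τ : Config n, ∏ j, Real.exp (l * (((σ j : ℤ) : ℝ) * ((τ j : ℤ) : ℝ))) := by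
        simp only [hoverlap, Finset.mul_sum, Real.exp_sum]
    _ = ∏ j, ∑ v : ℤˣ, Real.exp (l * (((σ j : ℤ) : ℝ) * ((v : ℤ) : ℝ))) :=
        (Fintype.prod_sum fun (j : Fin n) (v : ℤˣ) =>
          Real.exp (l * (((σ j : ℤ) : ℝ) * ((v : ℤ) : ℝ)))).symm
    _ = (2 * Real.cosh l) ^ n := by
        simp only [hsite, Finset.prod_const, Finset.card_univ, Fintype.card_fin]

lemma card_cap_le {l : ℝ} (hl : 0 ≤ l) (r : ℝ) (σ : Config n) :
    ((cap r σ).card : ℝ) ≤ 2 * (2 * Real.cosh l * Real.exp (-(l * r))) ^ n := by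
  have hmarkov : ∀ τ ∈ cap r σ, Real.exp (l * r * n) ≤
      Real.exp (l * (n * overlap σ τ)) + Real.exp (-l * (n * overlap σ τ)) := fun τ hτ => by
    calc Real.exp (l * r * n) ≤ Real.exp |l * (n * overlap σ τ)| := by
          rw [abs_mul, abs_mul, abs_of_nonneg hl, Nat.abs_cast, mul_comm (n : ℝ), ← mul_assoc]
          gcongr
          exact (Finset.mem_filter.1 hτ).2
      _ ≤ _ := by simpa only [neg_mul] using Real.exp_abs_le _
  calc ((cap r σ).card : ℝ)
      = (∑ _τ ∈ cap r σ, Real.exp (l * r * n)) * Real.exp (-(l * r)) ^ n := by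
        rw [Finset.sum_const, nsmul_eq_mul, ← Real.exp_nat_mul, mul_assoc, ← Real.exp_add]
        ring_nf
        simp
    _ ≤ (∑ τ, (Real.exp (l * (n * overlap σ τ)) + Real.exp (-l * (n * overlap σ τ)))) *
          Real.exp (-(l * r)) ^ n := by
        gcongr
        exact (Finset.sum_le_sum hmarkov).trans
          (Finset.sum_le_univ_sum_of_nonneg fun τ => by positivity)
    _ = 2 * (2 * Real.cosh l * Real.exp (-(l * r))) ^ n := by
        rw [Finset.sum_add_distrib, sum_exp_mul_overlap, sum_exp_mul_overlap, Real.cosh_neg,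
          mul_pow _ (Real.exp _)]
        ring

lemma exists_card_cap_le_exp {κ : ℝ} (hκ : 0 < κ) :
    ∃ r : ℝ, 0 < r ∧ r < 1 ∧ ∀ (n : ℕ) (σ : Config n),
      ((cap r σ).card : ℝ) ≤ 2 * Real.exp (κ * n) := by
  obtain ⟨l, hl, hexp⟩ : ∃ l : ℝ, 0 < l ∧ Real.exp (-(2 * l)) < κ / 2 := by
    have hlim : Tendsto (fun l : ℝ => Real.exp (-(2 * l))) atTop (nhds 0) :=
      Real.tendsto_exp_neg_atTop_nhds_zero.comp (tendsto_id.const_mul_atTop two_pos)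
    exact ((eventually_gt_atTop 0).and (hlim.eventually_lt_const (half_pos hκ))).exists
  have hratio : 0 < κ / (2 * l) := by positivity
  refine ⟨max (1 / 2) (1 - κ / (2 * l)), by positivity, max_lt (by norm_num) (by linarith),
    fun n σ => (card_cap_le hl.le _ σ).trans ?_⟩
  set r := max (1 / 2) (1 - κ / (2 * l))
  have hlr : l * (1 - r) ≤ κ / 2 := by
    calc l * (1 - r) ≤ l * (κ / (2 * l)) := by
          gcongr
          linarith [le_max_right (1 / 2) (1 - κ / (2 * l))]
      _ = κ / 2 := by field_simp
  rw [mul_comm κ, Real.exp_nat_mul]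
  have := Real.cosh_pos l
  gcongr
  calc 2 * Real.cosh l * Real.exp (-(l * r))
      = (1 + Real.exp (-(2 * l))) * Real.exp (l * (1 - r)) := by
        rw [Real.cosh_eq, mul_div_cancel₀ _ two_ne_zero, add_mul, add_mul, one_mul]
        simp only [← Real.exp_add]
        ring_nf
    _ ≤ Real.exp (κ / 2) * Real.exp (κ / 2) := by
        gcongr
        linarith [Real.add_one_le_exp (κ / 2)]
    _ = Real.exp κ := by rw [← Real.exp_add, add_halves]

lemma card_overlap_eq_le (σ : Config n) (r : ℝ) :
    ((Finset.univ.filter fun τ => overlap σ τ = r).card : ℝ) * Real.exp (r ^ 2 / 2 * n) ≤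
      2 ^ n := by
  have hchernoff : ((Finset.univ.filter fun τ => overlap σ τ = r).card : ℝ) *
      Real.exp (r * (n * r)) ≤ (2 * Real.cosh r) ^ n := by
    rw [← sum_exp_mul_overlap r σ, ← nsmul_eq_mul, ← Finset.sum_const]
    refine (Finset.sum_congr rfl fun τ hτ => ?_).trans_le
      (Finset.sum_le_univ_sum_of_nonneg fun τ => (Real.exp_pos _).le)
    rw [(Finset.mem_filter.1 hτ).2]
  have hcosh : (2 * Real.cosh r) ^ n ≤ 2 ^ n * Real.exp (r ^ 2 / 2 * n) := by
    rw [mul_pow, mul_comm (r ^ 2 / 2), Real.exp_nat_mul]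
    have := Real.cosh_pos r
    gcongr
    exact Real.cosh_le_exp_half_sq r
  refine le_of_mul_le_mul_right ?_ (Real.exp_pos (r ^ 2 / 2 * n))
  calc _ = ((Finset.univ.filter fun τ => overlap σ τ = r).card : ℝ) * Real.exp (r * (n * r)) := by
        rw [mul_assoc, ← Real.exp_add]
        ring_nf
    _ ≤ _ := hchernoff.trans hcosh

lemma card_image_overlap_le (σ : Config n) : (Finset.univ.image (overlap σ)).card ≤ n + 1 := by
  have hsub : Finset.univ.image (overlap σ) ⊆
      (Finset.range (n + 1)).image fun d : ℕ => ((n : ℝ) - 2 * d) / n := fun x hx => by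
    obtain ⟨τ, -, rfl⟩ := Finset.mem_image.1 hx
    have hdist := hammingDist_le_card_fintype (x := σ) (y := τ)
    rw [Fintype.card_fin] at hdist
    refine Finset.mem_image.2 ⟨hammingDist σ τ, Finset.mem_range.2 (Nat.lt_succ_of_le hdist), ?_⟩
    rcases eq_or_ne n 0 with rfl | hn
    · simp [overlap]
    · rw [← natCast_mul_overlap, mul_div_cancel_left₀ _ (Nat.cast_ne_zero.2 hn)]
  exact (Finset.card_le_card hsub).trans (Finset.card_image_le.trans_eq (Finset.card_range _))

lemma sum_exp_overlap_sq_le (σ : Config n) :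
    ∑ τ, Real.exp (overlap σ τ ^ 2 / 2 * n) ≤ (n + 1) * 2 ^ n := by
  calc ∑ τ, Real.exp (overlap σ τ ^ 2 / 2 * n)
      = ∑ r ∈ Finset.univ.image (overlap σ),
          ((Finset.univ.filter fun τ => overlap σ τ = r).card : ℝ) * Real.exp (r ^ 2 / 2 * n) := by
        simpa only [nsmul_eq_mul] using
          Finset.sum_comp (fun r => Real.exp (r ^ 2 / 2 * n)) (overlap σ)
    _ ≤ (Finset.univ.image (overlap σ)).card • (2 : ℝ) ^ n :=
        Finset.sum_le_card_nsmul _ _ _ fun r _ => card_overlap_eq_le σ r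
    _ ≤ (n + 1) * 2 ^ n := by
        rw [nsmul_eq_mul]
        gcongr
        exact_mod_cast card_image_overlap_le σ

lemma mul_pow_div_one_add_pow_le (hp : 2 ≤ p) {b r x : ℝ} (hb : 0 ≤ b)
    (hbr : b * r ^ (p - 2) ≤ 1 / 2) (hx : 0 ≤ x) (hxr : x ≤ r) :
    b * (x ^ p / (1 + x ^ p)) ≤ x ^ 2 / 2 := by
  calc b * (x ^ p / (1 + x ^ p)) ≤ b * x ^ p := by
        gcongr
        exact div_le_self (by positivity) (le_add_of_nonneg_right (by positivity))
    _ = b * x ^ (p - 2) * x ^ 2 := by rw [mul_assoc, ← pow_add, Nat.sub_add_cancel hp]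
    _ ≤ b * r ^ (p - 2) * x ^ 2 := by gcongr
    _ ≤ x ^ 2 / 2 := by nlinarith [sq_nonneg x]

/-- Quadratic overlaps dominate away from the caps, where `x ^ p ≤ r ^ (p - 2) * x ^ 2`; the caps
themselves contain too few configurations to matter. -/
lemma sum_exp_pow_overlap_le (hp : 2 ≤ p) {b r κ : ℝ} (hb : 0 ≤ b)
    (hbr : b * r ^ (p - 2) ≤ 1 / 2) (hbκ : b / 2 + κ ≤ Real.log 2) {σ : Config n}
    (hcap : ((cap r σ).card : ℝ) ≤ 2 * Real.exp (κ * n)) :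
    ∑ τ, Real.exp (b * (|overlap σ τ| ^ p / (1 + |overlap σ τ| ^ p)) * n) ≤ (n + 3) * 2 ^ n := by
  have hterm (τ : Config n) :
      Real.exp (b * (|overlap σ τ| ^ p / (1 + |overlap σ τ| ^ p)) * n) ≤
        Real.exp (overlap σ τ ^ 2 / 2 * n) + if τ ∈ cap r σ then Real.exp (b / 2 * n) else 0 := by
    split_ifs with hτ
    · have hpow : |overlap σ τ| ^ p ≤ 1 := pow_le_one₀ (abs_nonneg _) (abs_overlap_le_one σ τ)
      have hfrac : |overlap σ τ| ^ p / (1 + |overlap σ τ| ^ p) ≤ 1 / 2 := by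
        rw [div_le_div_iff₀ (by positivity) two_pos]
        linarith
      refine le_add_of_nonneg_of_le (Real.exp_pos _).le ?_
      gcongr
      linarith [mul_le_mul_of_nonneg_left hfrac hb]
    · have hxr : |overlap σ τ| ≤ r := by
        simpa [cap] using (not_le.1 fun h => hτ (Finset.mem_filter.2 ⟨Finset.mem_univ _, h⟩)).le
      rw [add_zero, ← sq_abs]
      gcongr
      exact mul_pow_div_one_add_pow_le hp hb hbr (abs_nonneg _) hxr
  have hcaps : ((cap r σ).card : ℝ) * Real.exp (b / 2 * n) ≤ 2 * 2 ^ n := by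
    calc ((cap r σ).card : ℝ) * Real.exp (b / 2 * n)
        ≤ 2 * Real.exp (κ * n) * Real.exp (b / 2 * n) := by gcongr
      _ = 2 * Real.exp (n * (b / 2 + κ)) := by
          rw [mul_assoc, ← Real.exp_add]
          ring_nf
      _ ≤ 2 * Real.exp (n * Real.log 2) := by gcongr
      _ = 2 * 2 ^ n := by rw [Real.exp_nat_mul, Real.exp_log two_pos]
  calc _ ≤ ∑ τ, (Real.exp (overlap σ τ ^ 2 / 2 * n) +
          if τ ∈ cap r σ then Real.exp (b / 2 * n) else 0) := Finset.sum_le_sum fun τ _ => hterm τ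
    _ = ∑ τ, Real.exp (overlap σ τ ^ 2 / 2 * n) + (cap r σ).card * Real.exp (b / 2 * n) := by
        rw [Finset.sum_add_distrib, Finset.sum_ite_mem, Finset.univ_inter, Finset.sum_const,
          nsmul_eq_mul]
    _ ≤ (n + 3) * 2 ^ n := by linarith [sum_exp_overlap_sq_le σ]

end OverlapCounting

section Clustering

variable {n : ℕ} {ν₁ ν₂ : ℝ} {A : Finset (Config n)}

lemma HasOGP.mono {B : Finset (Config n)} (h : HasOGP ν₁ ν₂ B) (hAB : A ⊆ B) : HasOGP ν₁ ν₂ A :=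
  fun σ hσ τ hτ => h σ (hAB hσ) τ (hAB hτ)

lemma HasOGP.hammingDist_le_trans (h : HasOGP ν₁ ν₂ A) (hn : n ≠ 0) (hν : ν₁ < ν₂ / 2)
    {σ τ υ : Config n} (hσ : σ ∈ A) (hυ : υ ∈ A) (hστ : (hammingDist σ τ : ℝ) ≤ ν₁ * n)
    (hτυ : (hammingDist τ υ : ℝ) ≤ ν₁ * n) : (hammingDist σ υ : ℝ) ≤ ν₁ * n := by
  refine (h σ hσ υ hυ).resolve_right fun hfar => ?_
  have htriangle : (hammingDist σ υ : ℝ) ≤ hammingDist σ τ + hammingDist τ υ := by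
    exact_mod_cast hammingDist_triangle σ τ υ
  have hn' : (0 : ℝ) < n := by positivity
  nlinarith

/-- Under the overlap gap property the clusters are the classes of configurations with the same
close neighbours. -/
lemma HasOGP.exists_isClustering (h : HasOGP ν₁ ν₂ A) (hn : n ≠ 0) (hν₁ : 0 ≤ ν₁)
    (hν : ν₁ < ν₂ / 2) : ∃ C : Finpartition A, IsClustering ν₁ ν₂ C := by
  classical
  let close (σ : Config n) : Finset (Config n) := A.filter fun τ => (hammingDist σ τ : ℝ) ≤ ν₁ * n
  let C := Finpartition.ofSetSetoid (Setoid.ker close) A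
  have hpart {c : Finset (Config n)} (hc : c ∈ C.parts) {σ τ : Config n} (hσ : σ ∈ c)
      (hτ : τ ∈ A) : τ ∈ c ↔ close σ = close τ := by
    rw [← C.part_eq_of_mem hc hσ, Finpartition.mem_part_ofSetSetoid_iff_rel]
    simp [Setoid.ker_def, hτ, C.le hc hσ]
  refine ⟨C, fun c hc σ hσ τ hτ => ?_, fun c hc d hd hcd σ hσ τ hτ => ?_⟩
  · have hτA := C.le hc hτ
    have hself : τ ∈ close τ := Finset.mem_filter.2 ⟨hτA, by simpa using by positivity⟩
    rw [← (hpart hc hσ hτA).1 hτ] at hself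
    exact (Finset.mem_filter.1 hself).2
  · have hσA := C.le hc hσ
    have hτA := C.le hd hτ
    refine (h σ hσA τ hτA).resolve_left fun hστ => hcd ?_
    refine C.eq_of_mem_parts hc hd ((hpart hc hσ hτA).2 (Finset.filter_congr fun υ hυ => ?_)) hτ
    have hτσ : (hammingDist τ σ : ℝ) ≤ ν₁ * n := by rwa [hammingDist_comm]
    exact ⟨h.hammingDist_le_trans hn hν hτA hυ hτσ, h.hammingDist_le_trans hn hν hσA hυ hστ⟩

lemma IsClustering.mem_part_iff {C : Finpartition A} (hC : IsClustering ν₁ ν₂ C) (hn : n ≠ 0)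
    (hν : ν₁ < ν₂) {σ τ : Config n} (hσ : σ ∈ A) :
    τ ∈ C.part σ ↔ τ ∈ A ∧ (hammingDist σ τ : ℝ) ≤ ν₁ * n := by
  refine ⟨fun h => ⟨C.le (C.part_mem.2 hσ) h,
    hC.1 _ (C.part_mem.2 hσ) σ (C.mem_part hσ) τ h⟩, fun ⟨hτ, hclose⟩ => ?_⟩
  by_contra h
  have hne : C.part σ ≠ C.part τ := fun heq => h (heq ▸ C.mem_part hτ)
  have hfar := hC.2 _ (C.part_mem.2 hσ) _ (C.part_mem.2 hτ) hne σ (C.mem_part hσ) τ (C.mem_part hτ)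
  have hn' : (0 : ℝ) < n := by positivity
  exact (hfar.trans hclose).not_gt (mul_lt_mul_of_pos_right hν hn')

lemma IsClustering.parts_subset {C D : Finpartition A} (hC : IsClustering ν₁ ν₂ C)
    (hD : IsClustering ν₁ ν₂ D) (hn : n ≠ 0) (hν : ν₁ < ν₂) : C.parts ⊆ D.parts := fun c hc => by
  obtain ⟨σ, hσ⟩ := C.nonempty_of_mem_parts hc
  have hσA := C.le hc hσ
  have heq : C.part σ = D.part σ := by
    ext τ
    rw [hC.mem_part_iff hn hν hσA, hD.mem_part_iff hn hν hσA]
  rw [← C.part_eq_of_mem hc hσ, heq]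
  exact D.part_mem.2 hσA

lemma HasOGP.existsUnique_isClustering (h : HasOGP ν₁ ν₂ A) (hn : n ≠ 0) (hν₁ : 0 ≤ ν₁)
    (hν : ν₁ < ν₂ / 2) : ∃! C : Finpartition A, IsClustering ν₁ ν₂ C := by
  obtain ⟨C, hC⟩ := h.exists_isClustering hn hν₁ hν
  have hν' : ν₁ < ν₂ := by linarith
  exact ⟨C, hC, fun D hD =>
    Finpartition.ext ((hD.parts_subset hC hn hν').antisymm (hC.parts_subset hD hn hν'))⟩

lemma IsClustering.subset_cap {C : Finpartition A} (hC : IsClustering ν₁ ν₂ C) (hn : n ≠ 0)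
    {r : ℝ} (hr : r ≤ 1 - 2 * ν₁) {c : Finset (Config n)} (hc : c ∈ C.parts) {σ : Config n}
    (hσ : σ ∈ c) : c ⊆ cap r σ := fun τ hτ => by
  refine Finset.mem_filter.2 ⟨Finset.mem_univ _, hr.trans (le_trans ?_ (le_abs_self _))⟩
  have hn' : (0 : ℝ) < n := by positivity
  have hclose := hC.1 c hc σ hσ τ hτ
  nlinarith [natCast_mul_overlap σ τ]

lemma card_le_card_parts_mul {α : Type*} [DecidableEq α] {s : Finset α} (C : Finpartition s) {M : ℝ}
    (hM : ∀ c ∈ C.parts, (c.card : ℝ) ≤ M) : (s.card : ℝ) ≤ C.parts.card * M := by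
  rw [← C.sum_card_parts, Nat.cast_sum, ← nsmul_eq_mul]
  exact Finset.sum_le_card_nsmul _ _ _ hM

end Clustering

section Asymptotics

lemma eventually_natCast_add_le_exp (C : ℝ) {θ : ℝ} (hθ : 0 < θ) :
    ∀ᶠ n : ℕ in atTop, n + C ≤ Real.exp (θ * n) := by
  have hlin : ∀ᶠ x : ℝ in atTop, 2 * x ≤ Real.exp (θ * x) := by
    filter_upwards [(isLittleO_pow_exp_pos_mul_atTop 1 hθ).bound (c := 1 / 2) (by norm_num)]
      with x hx
    rw [pow_one, Real.norm_eq_abs, Real.norm_of_nonneg (Real.exp_pos _).le] at hx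
    linarith [le_abs_self x]
  filter_upwards [tendsto_natCast_atTop_atTop.eventually hlin,
    tendsto_natCast_atTop_atTop.eventually (eventually_ge_atTop C)] with n hexp hC
  linarith

lemma eventually_const_mul_exp_le (C : ℝ) {a b : ℝ} (hab : a < b) :
    ∀ᶠ n : ℕ in atTop, C * Real.exp (a * n) ≤ Real.exp (b * n) := by
  filter_upwards [eventually_natCast_add_le_exp C (sub_pos.2 hab)] with n hn
  calc C * Real.exp (a * n) ≤ Real.exp ((b - a) * n) * Real.exp (a * n) := by
        gcongr
        linarith [n.cast_nonneg (α := ℝ)]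
    _ = Real.exp (b * n) := by
        rw [← Real.exp_add]
        ring_nf

/-- The events `E n` have probability at most `e^{-Θ(n)}` as `n → ∞`, for fixed `p`. -/
def ExpRare (p : ℕ) (E : (n : ℕ) → Set (Tensor n p)) : Prop :=
  ∃ c : ℝ, 0 < c ∧ ∀ᶠ n : ℕ in atTop, (disorder n p).real (E n) ≤ Real.exp (-c * n)

variable {p : ℕ} {E E' : (n : ℕ) → Set (Tensor n p)}

lemma expRare_of_le_const_mul (C : ℝ) {κ : ℝ} (hκ : 0 < κ)
    (h : ∀ᶠ n : ℕ in atTop, (disorder n p).real (E n) ≤ C * Real.exp (-κ * n)) : ExpRare p E := by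
  refine ⟨κ / 2, by positivity, ?_⟩
  filter_upwards [h, eventually_const_mul_exp_le C (neg_lt_neg (half_lt_self hκ))] with n hn hC
  exact hn.trans hC

lemma ExpRare.mono (h : ExpRare p E') (hE : ∀ᶠ n : ℕ in atTop, E n ⊆ E' n) : ExpRare p E := by
  obtain ⟨c, hc, h⟩ := h
  refine ⟨c, hc, ?_⟩
  filter_upwards [h, hE] with n hn hsub
  exact (measureReal_mono hsub).trans hn

lemma ExpRare.union (h : ExpRare p E) (h' : ExpRare p E') : ExpRare p fun n => E n ∪ E' n := by
  obtain ⟨c, hc, h⟩ := h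
  obtain ⟨c', hc', h'⟩ := h'
  refine expRare_of_le_const_mul 2 (lt_min hc hc') ?_
  filter_upwards [h, h'] with n hn hn'
  calc (disorder n p).real (E n ∪ E' n)
      ≤ (disorder n p).real (E n) + (disorder n p).real (E' n) := measureReal_union_le _ _
    _ ≤ Real.exp (-min c c' * n) + Real.exp (-min c c' * n) := by
        gcongr
        · exact hn.trans (by gcongr; exact min_le_left c c')
        · exact hn'.trans (by gcongr; exact min_le_right c c')
    _ = 2 * Real.exp (-min c c' * n) := by ring

lemma ExpRare.expLikely_compl (h : ExpRare p fun n => (E n)ᶜ) : ExpLikely p E := by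
  obtain ⟨c, hc, h⟩ := h
  refine ⟨c, hc, ?_⟩
  filter_upwards [h] with n hn
  have hunion := measureReal_union_le (μ := disorder n p) (E n) (E n)ᶜ
  rw [Set.union_compl_self, probReal_univ] at hunion
  linarith

end Asymptotics

section SuperLevel

variable {n p : ℕ}

/-- The energy that defines `superLevel J ε`. -/
noncomputable def threshold (ε : ℝ) : ℝ := (1 - ε) * √(2 * Real.log 2)

/-- The exponent of the first moment: `superLevel J ε` has `2 ^ (rate ε * n + o(n))` elements on
average. -/
def rate (ε : ℝ) : ℝ := 1 - (1 - ε) ^ 2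

lemma mem_superLevel {J : Tensor n p} {ε : ℝ} {σ : Config n} :
    σ ∈ superLevel J ε ↔ threshold ε ≤ hamiltonian J σ := by
  simp [superLevel, threshold]

lemma threshold_nonneg {ε : ℝ} (hε : ε ≤ 1) : 0 ≤ threshold ε :=
  mul_nonneg (sub_nonneg.2 hε) (Real.sqrt_nonneg _)

lemma threshold_sq (ε : ℝ) : threshold ε ^ 2 = 2 * Real.log 2 * (1 - rate ε) := by
  have : 0 < Real.log 2 := Real.log_pos one_lt_two
  rw [threshold, mul_pow, Real.sq_sqrt (by positivity), rate]
  ring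

lemma rate_pos {ε : ℝ} (h₀ : 0 < ε) (h₁ : ε < 1) : 0 < rate ε := by
  unfold rate
  nlinarith

lemma strictMonoOn_rate : StrictMonoOn rate (Set.Iic 1) := fun δ _ ε hε hδε => by
  unfold rate
  nlinarith [hε.out]

lemma continuous_rate : Continuous rate := by
  unfold rate
  fun_prop

lemma abs_hamiltonian_sub_hamiltonian_le (J J' : Tensor n p) (σ : Config n) :
    |hamiltonian J σ - hamiltonian J' σ| ≤
      (n : ℝ) ^ (-(((p : ℝ) + 1) / 2)) * ∑ i, |J i - J' i| := by
  have hspin (u : ℤˣ) : |((u : ℤ) : ℝ)| = 1 := by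
    rcases Int.units_eq_one_or u with rfl | rfl <;> simp
  have habs (i : Fin p → Fin n) : |spinTensor p σ i| = (n : ℝ) ^ (-(((p : ℝ) + 1) / 2)) := by
    rw [spinTensor, abs_mul, Finset.abs_prod, abs_of_nonneg (by positivity)]
    simp only [hspin, Finset.prod_const_one, mul_one]
  rw [hamiltonian_eq_sum_spinTensor, hamiltonian_eq_sum_spinTensor, ← Finset.sum_sub_distrib,
    Finset.mul_sum]
  refine (Finset.abs_sum_le_sum_abs _ _).trans_eq (Finset.sum_congr rfl fun i _ => ?_)
  rw [← mul_sub, abs_mul, habs]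

lemma le_sum_abs_sub_of_card_superLevel_lt (hn : n ≠ 0) {J J' : Tensor n p} {δ ε : ℝ}
    (hcard : (superLevel J' ε).card < (superLevel J δ).card) :
    (ε - δ) * √(2 * Real.log 2) * (n : ℝ) ^ (((p : ℝ) + 1) / 2) ≤ ∑ i, |J i - J' i| := by
  obtain ⟨σ, hσ, hσ'⟩ := Finset.exists_mem_notMem_of_card_lt_card hcard
  have hgap : (ε - δ) * √(2 * Real.log 2) ≤ |hamiltonian J σ - hamiltonian J' σ| := by
    rw [mem_superLevel, threshold] at hσ hσ'
    refine le_trans ?_ (le_abs_self _)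
    linarith
  have hn' : (0 : ℝ) < n := by positivity
  rw [← le_div_iff₀ (by positivity), div_eq_inv_mul, ← Real.rpow_neg hn'.le]
  exact hgap.trans (abs_hamiltonian_sub_hamiltonian_le J J' σ)

lemma measureReal_mul_measureReal_card_superLevel_le (hn : n ≠ 0) {δ ε : ℝ} (hδε : δ ≤ ε)
    (K : ℝ) :
    (disorder n p).real {J | K ≤ (superLevel J δ).card} *
        (disorder n p).real {J | ((superLevel J ε).card : ℝ) < K} ≤
      Real.exp (-((ε - δ) ^ 2 * Real.log 2 / 4 * n)) := by
  have : 0 < Real.log 2 := Real.log_pos one_lt_two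
  have hn' : (0 : ℝ) < n := by positivity
  have hscale : ((n : ℝ) ^ (((p : ℝ) + 1) / 2)) ^ 2 = (n : ℝ) ^ p * n := by
    rw [← Real.rpow_mul_natCast hn'.le, ← pow_succ, ← Real.rpow_natCast]
    push_cast
    ring_nf
  refine (measureReal_mul_measureReal_le_of_separated (c := 1)
    (d := (ε - δ) * √(2 * Real.log 2) * (n : ℝ) ^ (((p : ℝ) + 1) / 2))
    (hasSubgaussianMGF_id_gaussianReal le_rfl) (by have := sub_nonneg.2 hδε; positivity)
    fun J hJ J' hJ' => le_sum_abs_sub_of_card_superLevel_lt hn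
      (Nat.cast_lt.1 (hJ'.out.trans_le hJ.out))).trans_eq ?_
  rw [mul_pow, mul_pow, Real.sq_sqrt (by positivity), hscale]
  simp only [Fintype.card_pi, Fintype.card_fin, Finset.prod_const, Finset.card_univ,
    Nat.cast_pow, NNReal.coe_one]
  congr 1
  field_simp
  ring

end SuperLevel

section Moments

variable {Ω ι : Type*} [MeasurableSpace Ω] {μ : Measure Ω}

lemma integral_sum_indicator_one [IsFiniteMeasure μ] [Fintype ι] {E : ι → Set Ω}
    (hE : ∀ i, MeasurableSet (E i)) :
    ∫ ω, ∑ i, (E i).indicator (1 : Ω → ℝ) ω ∂μ = ∑ i, μ.real (E i) := by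
  rw [integral_finsetSum _ fun i _ => (integrable_const 1).indicator (hE i)]
  exact Finset.sum_congr rfl fun i _ => integral_indicator_one (hE i)

lemma integral_sum_indicator_one_sq [IsFiniteMeasure μ] [Fintype ι] {E : ι → Set Ω}
    (hE : ∀ i, MeasurableSet (E i)) :
    ∫ ω, (∑ i, (E i).indicator (1 : Ω → ℝ) ω) ^ 2 ∂μ = ∑ i, ∑ j, μ.real (E i ∩ E j) := by
  have hsq (ω : Ω) : (∑ i, (E i).indicator (1 : Ω → ℝ) ω) ^ 2 =
      ∑ ij : ι × ι, (E ij.1 ∩ E ij.2).indicator (1 : Ω → ℝ) ω := by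
    rw [sq, Fintype.sum_mul_sum, Fintype.sum_prod_type]
    simp only [Set.inter_indicator_one, Pi.mul_apply]
  simp only [hsq]
  exact (integral_sum_indicator_one fun ij : ι × ι => (hE ij.1).inter (hE ij.2)).trans
    (Fintype.sum_prod_type _)

lemma sq_integral_mul_le {f g : Ω → ℝ} (hf : MemLp f 2 μ) (hg : MemLp g 2 μ) :
    (∫ ω, f ω * g ω ∂μ) ^ 2 ≤ (∫ ω, f ω ^ 2 ∂μ) * ∫ ω, g ω ^ 2 ∂μ := by
  have hHolder := integral_mul_norm_le_Lp_mul_Lq (μ := μ) (f := f) (g := g)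
    Real.HolderConjugate.two_two (by simpa using hf) (by simpa using hg)
  simp only [Real.norm_eq_abs, Real.rpow_two, sq_abs, ← Real.sqrt_eq_rpow, ← abs_mul] at hHolder
  have hle := abs_integral_le_integral_abs.trans hHolder
  rw [← Real.sqrt_mul (integral_nonneg fun _ => sq_nonneg _)] at hle
  exact (Real.sq_le (mul_nonneg (integral_nonneg fun _ => sq_nonneg _)
    (integral_nonneg fun _ => sq_nonneg _))).2 (abs_le.1 hle)

lemma paley_zygmund [IsProbabilityMeasure μ] {N : Ω → ℝ} (hN : Measurable N)
    (hN2 : MemLp N 2 μ) {θ : ℝ} (hθ₀ : 0 ≤ θ) (hθ₁ : θ ≤ 1) (hmean : 0 ≤ ∫ ω, N ω ∂μ) :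
    ((1 - θ) * ∫ ω, N ω ∂μ) ^ 2 ≤
      (∫ ω, N ω ^ 2 ∂μ) * μ.real {ω | θ * ∫ ω, N ω ∂μ ≤ N ω} := by
  set m := ∫ ω, N ω ∂μ
  set B := {ω | θ * m ≤ N ω}
  have hB : MeasurableSet B := measurableSet_le measurable_const hN
  have hind : MemLp (B.indicator (1 : Ω → ℝ)) 2 μ := memLp_indicator_const 2 hB 1 (by simp)
  have hNind : Integrable (fun ω => N ω * B.indicator (1 : Ω → ℝ) ω) μ := hN2.integrable_mul hind
  have hpoint (ω : Ω) : N ω ≤ θ * m + N ω * B.indicator (1 : Ω → ℝ) ω := by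
    by_cases hω : ω ∈ B
    · simp [hω, mul_nonneg hθ₀ hmean]
    · simpa [hω] using (not_le.1 hω).le
  have hlarge : (1 - θ) * m ≤ ∫ ω, N ω * B.indicator (1 : Ω → ℝ) ω ∂μ := by
    have hint := integral_mono (hN2.integrable one_le_two) ((integrable_const (θ * m)).add hNind)
      hpoint
    simp only [Pi.add_apply] at hint
    rw [integral_add (integrable_const _) hNind, integral_const, probReal_univ, one_smul] at hint
    linarith
  calc ((1 - θ) * m) ^ 2 ≤ (∫ ω, N ω * B.indicator (1 : Ω → ℝ) ω ∂μ) ^ 2 :=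
        pow_le_pow_left₀ (mul_nonneg (sub_nonneg.2 hθ₁) hmean) hlarge 2
    _ ≤ (∫ ω, N ω ^ 2 ∂μ) * ∫ ω, B.indicator (1 : Ω → ℝ) ω ^ 2 ∂μ := sq_integral_mul_le hN2 hind
    _ = (∫ ω, N ω ^ 2 ∂μ) * μ.real B := by
        rw [← integral_indicator_one hB]
        congr 2
        ext ω
        by_cases hω : ω ∈ B <;> simp [hω]

lemma sq_le_mul_measureReal_of_integral_sq_le [IsProbabilityMeasure μ] {N : Ω → ℝ}
    (hN : Measurable N) (hN2 : MemLp N 2 μ) {a s K : ℝ} (ha : 0 < a) (hs : 0 ≤ s)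
    (hmean : s * a ≤ ∫ ω, N ω ∂μ) (hsq : ∫ ω, N ω ^ 2 ∂μ ≤ K * a ^ 2) :
    s ^ 2 ≤ 4 * K * μ.real {ω | s * a / 2 ≤ N ω} := by
  have hmean₀ : 0 ≤ s * a := mul_nonneg hs ha.le
  have hPZ := paley_zygmund hN hN2 one_half_pos.le one_half_lt_one.le (hmean₀.trans hmean)
  have hsubset : {ω | 1 / 2 * ∫ ω, N ω ∂μ ≤ N ω} ⊆ {ω | s * a / 2 ≤ N ω} :=
    fun ω hω => le_trans (by linarith) hω.out
  refine le_of_mul_le_mul_right ?_ (pow_pos ha 2)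
  calc s ^ 2 * a ^ 2 = 4 * ((1 - 1 / 2) * (s * a)) ^ 2 := by ring
    _ ≤ 4 * ((1 - 1 / 2) * ∫ ω, N ω ∂μ) ^ 2 := by gcongr
    _ ≤ 4 * ((∫ ω, N ω ^ 2 ∂μ) * μ.real {ω | 1 / 2 * ∫ ω, N ω ∂μ ≤ N ω}) := by gcongr
    _ ≤ 4 * (K * a ^ 2 * μ.real {ω | s * a / 2 ≤ N ω}) := by
        gcongr ?_ * ?_
        exact mul_le_mul hsq (measureReal_mono hsubset) measureReal_nonneg
          ((integral_nonneg fun ω => sq_nonneg (N ω)).trans hsq)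
    _ = 4 * K * μ.real {ω | s * a / 2 ≤ N ω} * a ^ 2 := by ring

end Moments

section SuperLevelMoments

variable {n p : ℕ}

lemma two_rpow_mul (c x : ℝ) : (2 : ℝ) ^ (c * x) = Real.exp (c * Real.log 2 * x) := by
  rw [Real.rpow_def_of_pos two_pos]
  ring_nf

lemma measurableSet_le_hamiltonian (a : ℝ) (σ : Config n) :
    MeasurableSet {J : Tensor n p | a ≤ hamiltonian J σ} :=
  measurableSet_le measurable_const (measurable_hamiltonian σ)

lemma card_superLevel_eq_sum_indicator (J : Tensor n p) (δ : ℝ) :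
    ((superLevel J δ).card : ℝ) =
      ∑ σ, {J : Tensor n p | threshold δ ≤ hamiltonian J σ}.indicator (1 : Tensor n p → ℝ) J := by
  rw [Finset.card_eq_sum_ones, Nat.cast_sum, ← Finset.sum_subset (Finset.subset_univ _)]
  · refine Finset.sum_congr rfl fun σ hσ => ?_
    simp [mem_superLevel.1 hσ]
  · intro σ _ hσ
    simpa [mem_superLevel] using hσ

lemma measurable_card_superLevel (δ : ℝ) :
    Measurable fun J : Tensor n p => ((superLevel J δ).card : ℝ) := by
  simp only [card_superLevel_eq_sum_indicator]
  exact Finset.measurable_fun_sum _ fun σ _ =>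
    measurable_one.indicator (measurableSet_le_hamiltonian _ σ)

lemma memLp_card_superLevel (δ : ℝ) (q : ENNReal) :
    MemLp (fun J : Tensor n p => ((superLevel J δ).card : ℝ)) q (disorder n p) := by
  simp only [card_superLevel_eq_sum_indicator]
  exact memLp_finsetSum _ fun σ _ =>
    memLp_indicator_const q (measurableSet_le_hamiltonian _ σ) 1 (.inr (measure_ne_top _ _))

lemma integral_card_superLevel (n p : ℕ) (δ : ℝ) :
    ∫ J, ((superLevel J δ).card : ℝ) ∂disorder n p =
      ∑ σ : Config n, (disorder n p).real {J | threshold δ ≤ hamiltonian J σ} := by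
  simp only [card_superLevel_eq_sum_indicator]
  exact integral_sum_indicator_one fun σ => measurableSet_le_hamiltonian _ σ

lemma two_pow_mul_exp_threshold (n : ℕ) (δ θ : ℝ) :
    2 ^ n * Real.exp (-((threshold δ ^ 2 / 2 + θ) * n)) =
      Real.exp ((rate δ * Real.log 2 - θ) * n) := by
  rw [← Real.rpow_natCast, Real.rpow_def_of_pos two_pos, ← Real.exp_add, threshold_sq]
  ring_nf

lemma integral_card_superLevel_le (hn : n ≠ 0) {δ : ℝ} (hδ : δ ≤ 1) :
    ∫ J, ((superLevel J δ).card : ℝ) ∂disorder n p ≤ Real.exp (rate δ * Real.log 2 * n) := by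
  calc ∫ J, ((superLevel J δ).card : ℝ) ∂disorder n p
      ≤ ∑ _σ : Config n, Real.exp (-(threshold δ ^ 2 / 2 * n)) := by
        rw [integral_card_superLevel]
        exact Finset.sum_le_sum fun σ _ => measureReal_le_hamiltonian_le hn (threshold_nonneg hδ) σ
    _ = Real.exp (rate δ * Real.log 2 * n) := by
        simpa using two_pow_mul_exp_threshold n δ 0

lemma eventually_exp_le_integral_card_superLevel (p : ℕ) {δ θ : ℝ} (hδ : δ ≤ 1) (hθ : 0 < θ) :
    ∀ᶠ n : ℕ in atTop, Real.exp ((rate δ * Real.log 2 - θ) * n) ≤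
      ∫ J, ((superLevel J δ).card : ℝ) ∂disorder n p := by
  filter_upwards [eventually_exp_le_measureReal_le_hamiltonian p (threshold_nonneg hδ) hθ]
    with n hn
  calc Real.exp ((rate δ * Real.log 2 - θ) * n)
      = ∑ _σ : Config n, Real.exp (-((threshold δ ^ 2 / 2 + θ) * n)) := by
        simp [← two_pow_mul_exp_threshold]
    _ ≤ ∫ J, ((superLevel J δ).card : ℝ) ∂disorder n p := by
        rw [integral_card_superLevel]
        exact Finset.sum_le_sum fun σ _ => hn σ

lemma expRare_two_rpow_le_card_superLevel (p : ℕ) {δ c : ℝ} (hδ : δ ≤ 1) (hc : rate δ < c) :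
    ExpRare p fun n => {J | (2 : ℝ) ^ (c * n) ≤ (superLevel J δ).card} := by
  refine ⟨(c - rate δ) * Real.log 2, mul_pos (sub_pos.2 hc) (Real.log_pos one_lt_two), ?_⟩
  filter_upwards [eventually_ne_atTop 0] with n hn
  have hmarkov := (mul_meas_ge_le_integral_of_nonneg (ae_of_all _ fun _ => Nat.cast_nonneg _)
    ((memLp_card_superLevel δ 1).integrable le_rfl) ((2 : ℝ) ^ (c * n))).trans
      (integral_card_superLevel_le (p := p) hn hδ)
  rw [two_rpow_mul, ← le_div_iff₀' (Real.exp_pos _), ← Real.exp_sub] at hmarkov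
  rw [two_rpow_mul]
  refine hmarkov.trans_eq ?_
  ring_nf

lemma integral_card_superLevel_sq_le (hn : n ≠ 0) (hp : 2 ≤ p) {δ r κ : ℝ} (hδ : δ ≤ 1)
    (hr : threshold δ ^ 2 * r ^ (p - 2) ≤ 1 / 2) (hκ : κ ≤ rate δ * Real.log 2)
    (hcap : ∀ σ : Config n, ((cap r σ).card : ℝ) ≤ 2 * Real.exp (κ * n)) :
    ∫ J, ((superLevel J δ).card : ℝ) ^ 2 ∂disorder n p ≤
      (n + 3) * Real.exp (rate δ * Real.log 2 * n) ^ 2 := by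
  have hpair (σ τ : Config n) :
      (disorder n p).real ({J | threshold δ ≤ hamiltonian J σ} ∩
        {J | threshold δ ≤ hamiltonian J τ}) ≤ Real.exp (-(threshold δ ^ 2 * n)) *
          Real.exp (threshold δ ^ 2 * (|overlap σ τ| ^ p / (1 + |overlap σ τ| ^ p)) * n) := by
    refine (measureReal_le_hamiltonian_and_le hn (threshold_nonneg hδ) σ τ).trans_eq ?_
    have : 0 < 1 + |overlap σ τ| ^ p := by positivity
    rw [← Real.exp_add]
    congr 1
    field_simp
    ring
  simp only [card_superLevel_eq_sum_indicator]
  rw [integral_sum_indicator_one_sq fun σ => measurableSet_le_hamiltonian _ σ]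
  calc _ ≤ ∑ _σ : Config n, Real.exp (-(threshold δ ^ 2 * n)) * ((n + 3) * 2 ^ n) := by
        refine Finset.sum_le_sum fun σ _ => (Finset.sum_le_sum fun τ _ => hpair σ τ).trans ?_
        rw [← Finset.mul_sum]
        refine mul_le_mul_of_nonneg_left (sum_exp_pow_overlap_le hp (sq_nonneg _) hr ?_ (hcap σ))
          (Real.exp_pos _).le
        rw [threshold_sq]
        linarith
    _ = (n + 3) * (2 ^ n * Real.exp (-((threshold δ ^ 2 / 2 + 0) * n))) ^ 2 := by
        rw [mul_pow, ← Real.exp_nat_mul, Finset.sum_const, nsmul_eq_mul]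
        simp only [Finset.card_univ, Fintype.card_pi, Fintype.card_units_int, Finset.prod_const,
          Fintype.card_fin]
        push_cast
        ring_nf
    _ = (n + 3) * Real.exp (rate δ * Real.log 2 * n) ^ 2 := by
        rw [two_pow_mul_exp_threshold, sub_zero]

end SuperLevelMoments

section SecondMoment

lemma exists_forall_mul_pow_sub_le (C : ℝ) {r s : ℝ} (hr₀ : 0 ≤ r) (hr₁ : r < 1) (hs : 0 < s)
    (k : ℕ) : ∃ P : ℕ, ∀ p, P ≤ p → C * r ^ (p - k) ≤ s := by
  have hlim : Tendsto (fun p : ℕ => C * r ^ (p - k)) atTop (nhds (C * 0)) :=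
    ((tendsto_pow_atTop_nhds_zero_of_lt_one hr₀ hr₁).comp (tendsto_sub_atTop_nat k)).const_mul C
  rw [mul_zero] at hlim
  exact eventually_atTop.1 (hlim.eventually_le_const hs)

lemma exists_integral_card_superLevel_sq_le {ε : ℝ} (hε₀ : 0 < ε) (hε₁ : ε < 1) :
    ∃ P : ℕ, ∀ p, P ≤ p → ∀ δ, ε ≤ δ → δ ≤ 1 → ∀ n : ℕ, n ≠ 0 →
      ∫ J, ((superLevel J δ).card : ℝ) ^ 2 ∂disorder n p ≤
        (n + 3) * Real.exp (rate δ * Real.log 2 * n) ^ 2 := by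
  have hlog : 0 < Real.log 2 := Real.log_pos one_lt_two
  obtain ⟨r, hr₀, hr₁, hcap⟩ := exists_card_cap_le_exp (mul_pos (rate_pos hε₀ hε₁) hlog)
  obtain ⟨P, hP⟩ := exists_forall_mul_pow_sub_le (2 * Real.log 2) hr₀.le hr₁ one_half_pos 2
  refine ⟨max P 2, fun p hp δ hεδ hδ n hn => ?_⟩
  have hrate : rate ε ≤ rate δ := strictMonoOn_rate.monotoneOn hε₁.le hδ hεδ
  have hthreshold : threshold δ ^ 2 ≤ 2 * Real.log 2 := by
    rw [threshold_sq]
    exact mul_le_of_le_one_right (by positivity) (by linarith [rate_pos hε₀ hε₁])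
  refine integral_card_superLevel_sq_le hn (le_of_max_le_right hp) hδ ?_ (by gcongr) (hcap n)
  exact (mul_le_mul_of_nonneg_right hthreshold (by positivity)).trans (hP p (le_of_max_le_left hp))

lemma eventually_exp_neg_le_measureReal_card_superLevel {p : ℕ} {δ c θ : ℝ} (hδ : δ ≤ 1)
    (hc : c < rate δ) (hθ : 0 < θ)
    (hsq : ∀ n : ℕ, n ≠ 0 → ∫ J, ((superLevel J δ).card : ℝ) ^ 2 ∂disorder n p ≤
      (n + 3) * Real.exp (rate δ * Real.log 2 * n) ^ 2) :
    ∀ᶠ n : ℕ in atTop, Real.exp (-θ * n) ≤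
      (disorder n p).real {J | (2 : ℝ) ^ (c * n) ≤ (superLevel J δ).card} := by
  have hgap : 0 < (rate δ - c) * Real.log 2 := mul_pos (sub_pos.2 hc) (Real.log_pos one_lt_two)
  obtain ⟨η, hη, hηmin⟩ := exists_between (lt_min (show 0 < θ / 4 by positivity) hgap)
  obtain ⟨hηθ, hηc⟩ := lt_min_iff.1 hηmin
  have hcη : c * Real.log 2 < rate δ * Real.log 2 - η := by linarith
  filter_upwards [eventually_exp_le_integral_card_superLevel p hδ hη,
    eventually_const_mul_exp_le 2 hcη, eventually_natCast_add_le_exp 4 (θ := θ / 4) (by positivity),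
    eventually_ne_atTop 0] with n hmean htwo hθ4 hn
  have : (0 : ℝ) ≤ n := n.cast_nonneg
  set a := Real.exp (rate δ * Real.log 2 * n)
  set Q := (disorder n p).real {J | (2 : ℝ) ^ (c * n) ≤ (superLevel J δ).card}
  have hfactor : Real.exp ((rate δ * Real.log 2 - η) * n) = Real.exp (-η * n) * a := by
    rw [← Real.exp_add]
    ring_nf
  rw [hfactor] at hmean htwo
  have hhalf : (2 : ℝ) ^ (c * n) ≤ Real.exp (-η * n) * a / 2 := by
    rwa [two_rpow_mul, le_div_iff₀' two_pos]
  have hQ : Real.exp (-η * n) ^ 2 ≤ Real.exp (θ / 4 * n) ^ 2 * Q := by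
    calc Real.exp (-η * n) ^ 2 ≤ 4 * (n + 3) * (disorder n p).real
            {J | Real.exp (-η * n) * a / 2 ≤ (superLevel J δ).card} :=
          sq_le_mul_measureReal_of_integral_sq_le (measurable_card_superLevel δ)
            (memLp_card_superLevel δ 2) (Real.exp_pos _) (Real.exp_pos _).le hmean
            (hsq n hn)
      _ ≤ 4 * (n + 3) * Q := by
          gcongr
          exact measureReal_mono fun J hJ => hhalf.trans hJ
      _ ≤ (n + 4) ^ 2 * Q := by
          gcongr
          nlinarith
      _ ≤ Real.exp (θ / 4 * n) ^ 2 * Q := by gcongr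
  refine le_of_mul_le_mul_left (hQ.trans' ?_) (by positivity : 0 < Real.exp (θ / 4 * n) ^ 2)
  rw [← Real.exp_nat_mul, ← Real.exp_nat_mul, ← Real.exp_add]
  gcongr
  push_cast
  nlinarith

lemma exists_expRare_card_superLevel_lt {ε : ℝ} (hε₀ : 0 < ε) (hε₁ : ε < 1) :
    ∃ P : ℕ, ∀ p, P ≤ p → ∀ c, c < rate ε →
      ExpRare p fun n => {J | ((superLevel J ε).card : ℝ) < (2 : ℝ) ^ (c * n)} := by
  obtain ⟨P, hP⟩ := exists_integral_card_superLevel_sq_le (half_pos hε₀) (by linarith)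
  refine ⟨P, fun p hp c hc => ?_⟩
  obtain ⟨δ, hcδ, hδ⟩ : ∃ δ, c < rate δ ∧ δ ∈ Set.Ioo (ε / 2) ε :=
    ((continuous_rate.continuousAt.eventually_const_lt hc).filter_mono nhdsWithin_le_nhds |>.and
      (Ioo_mem_nhdsLT (half_lt_self hε₀))).exists
  set θ := (ε - δ) ^ 2 * Real.log 2 / 8
  have hθ : 0 < θ := by
    have := sub_pos.2 hδ.2
    have := Real.log_pos one_lt_two
    positivity
  refine ⟨θ, hθ, ?_⟩
  filter_upwards [eventually_exp_neg_le_measureReal_card_superLevel (by linarith [hδ.2]) hcδ hθ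
    (hP p hp δ hδ.1.le (by linarith [hδ.2])), eventually_ne_atTop 0] with n hlarge hn
  refine le_of_mul_le_mul_left ?_ (Real.exp_pos (-θ * n))
  calc Real.exp (-θ * n) * (disorder n p).real {J | ((superLevel J ε).card : ℝ) < 2 ^ (c * n)}
      ≤ (disorder n p).real {J | (2 : ℝ) ^ (c * n) ≤ (superLevel J δ).card} *
          (disorder n p).real {J | ((superLevel J ε).card : ℝ) < 2 ^ (c * n)} := by gcongr
    _ ≤ Real.exp (-((ε - δ) ^ 2 * Real.log 2 / 4 * n)) :=
        measureReal_mul_measureReal_card_superLevel_le hn hδ.2.le _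
    _ = Real.exp (-θ * n) * Real.exp (-θ * n) := by
        rw [← Real.exp_add]
        congr 1
        ring

lemma expRare_card_superLevel_sdiff_lt {p : ℕ} {δ ε c : ℝ} (hε : ε ≤ 1) (hδ : δ < ε)
    (hc : c < rate ε) (hcard : ∀ b, b < rate ε →
      ExpRare p fun n => {J | ((superLevel J ε).card : ℝ) < (2 : ℝ) ^ (b * n)}) :
    ExpRare p fun n => {J | ((superLevel J ε \ superLevel J δ).card : ℝ) < (2 : ℝ) ^ (c * n)} := by
  obtain ⟨a, ha, haε⟩ := exists_between (max_lt hc (strictMonoOn_rate (hδ.le.trans hε) hε hδ))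
  obtain ⟨b, hab, hb⟩ := exists_between haε
  have hablog : a * Real.log 2 < b * Real.log 2 := by gcongr
  refine ((hcard b hb).union (expRare_two_rpow_le_card_superLevel p (hδ.le.trans hε)
    (max_lt_iff.1 ha).2)).mono ?_
  filter_upwards [eventually_const_mul_exp_le 2 hablog] with n hdouble J hJ
  rw [← two_rpow_mul, ← two_rpow_mul] at hdouble
  have hca : (2 : ℝ) ^ (c * n) ≤ (2 : ℝ) ^ (a * n) := by
    gcongr
    · exact one_le_two
    · exact (max_lt_iff.1 ha).1.le
  have hsub : ((superLevel J ε).card : ℝ) ≤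
      (superLevel J ε \ superLevel J δ).card + (superLevel J δ).card := by
    exact_mod_cast Finset.card_le_card_sdiff_add_card
  by_contra! hnot
  simp only [Set.mem_union, Set.mem_ofPred_eq, not_or, not_lt, not_le] at hnot hJ
  linarith

end SecondMoment

section OverlapGap

lemma exists_overlap_mem_Ioo_of_not_hasOGP {n : ℕ} {ν₁ ν₂ : ℝ} {A : Finset (Config n)}
    (h : ¬ HasOGP ν₁ ν₂ A) :
    ∃ σ ∈ A, ∃ τ ∈ A, overlap σ τ ∈ Set.Ioo (1 - 2 * ν₂) (1 - 2 * ν₁) := by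
  simp only [HasOGP, not_forall, not_or, not_le, exists_prop] at h
  obtain ⟨σ, hσ, τ, hτ, hν₁, hν₂⟩ := h
  have hn : (0 : ℝ) < n := by
    rcases n.eq_zero_or_pos with rfl | hn
    · simp [Subsingleton.elim σ τ] at hν₁ hν₂
    · exact_mod_cast hn
  have hoverlap := natCast_mul_overlap σ τ
  refine ⟨σ, hσ, τ, hτ, ?_, ?_⟩ <;> refine lt_of_mul_lt_mul_left ?_ hn.le <;> linarith

lemma measureReal_le_hamiltonian_and_le_of_mul_pow_le {n p : ℕ} (hn : n ≠ 0) {a κ : ℝ}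
    (ha : 0 ≤ a) (hκ : 0 ≤ κ) {σ τ : Config n} (h : a ^ 2 * |overlap σ τ| ^ p ≤ κ) :
    (disorder n p).real {J | a ≤ hamiltonian J σ ∧ a ≤ hamiltonian J τ} ≤
      Real.exp (-((a ^ 2 - κ) * n)) := by
  refine (measureReal_le_hamiltonian_and_le hn ha σ τ).trans ?_
  gcongr
  rw [le_div_iff₀ (by positivity)]
  nlinarith [mul_nonneg hκ (pow_nonneg (abs_nonneg (overlap σ τ)) p)]

lemma measureReal_not_hasOGP_le {n p : ℕ} (hn : n ≠ 0) {ε κ K r ν₁ ν₂ : ℝ} (hε : ε ≤ 1)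
    (hκ : 0 ≤ κ) (hr : 0 ≤ r) (hν₂ : r ≤ 1 - 2 * ν₂) (hpow : threshold ε ^ 2 * (1 - 2 * ν₁) ^ p ≤ κ)
    (hcap : ∀ σ : Config n, ((cap r σ).card : ℝ) ≤ K) :
    (disorder n p).real {J | ¬ HasOGP ν₁ ν₂ (superLevel J ε)} ≤
      2 ^ n * K * Real.exp (-((threshold ε ^ 2 - κ) * n)) := by
  let pairs : Finset (Σ _ : Config n, Config n) :=
    Finset.univ.sigma fun σ => (cap r σ).filter fun τ => |overlap σ τ| ≤ 1 - 2 * ν₁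
  let joint (x : Σ _ : Config n, Config n) : Set (Tensor n p) :=
    {J | threshold ε ≤ hamiltonian J x.1 ∧ threshold ε ≤ hamiltonian J x.2}
  have hsubset : {J : Tensor n p | ¬ HasOGP ν₁ ν₂ (superLevel J ε)} ⊆ ⋃ x ∈ pairs, joint x := by
    intro J hJ
    obtain ⟨σ, hσ, τ, hτ, hlo, hhi⟩ := exists_overlap_mem_Ioo_of_not_hasOGP hJ
    refine Set.mem_biUnion (x := ⟨σ, τ⟩) ?_ ⟨mem_superLevel.1 hσ, mem_superLevel.1 hτ⟩
    simp only [pairs, cap, Finset.coe_sigma, Set.mem_sigma_iff, Finset.mem_coe, Finset.mem_filter,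
      Finset.mem_univ, true_and, abs_of_nonneg (show 0 ≤ overlap σ τ by linarith)]
    exact ⟨by linarith, hhi.le⟩
  have hcard : (pairs.card : ℝ) ≤ 2 ^ n * K := by
    rw [Finset.card_sigma, Nat.cast_sum]
    calc _ ≤ ∑ _σ : Config n, K := Finset.sum_le_sum fun σ _ =>
          (Nat.cast_le.2 (Finset.card_filter_le _ _)).trans (hcap σ)
      _ = 2 ^ n * K := by simp
  have hjoint (x) (hx : x ∈ pairs) :
      (disorder n p).real (joint x) ≤ Real.exp (-((threshold ε ^ 2 - κ) * n)) := by
    have hoverlap := (Finset.mem_filter.1 (Finset.mem_sigma.1 hx).2).2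
    exact measureReal_le_hamiltonian_and_le_of_mul_pow_le hn (threshold_nonneg hε) hκ
      (hpow.trans' (by gcongr))
  calc (disorder n p).real {J : Tensor n p | ¬ HasOGP ν₁ ν₂ (superLevel J ε)}
      ≤ ∑ x ∈ pairs, (disorder n p).real (joint x) :=
        (measureReal_mono hsubset (measure_ne_top _ _)).trans (measureReal_biUnion_finset_le _ _)
    _ ≤ pairs.card * Real.exp (-((threshold ε ^ 2 - κ) * n)) := by
        rw [← nsmul_eq_mul]
        exact Finset.sum_le_card_nsmul _ _ _ hjoint
    _ ≤ 2 ^ n * K * Real.exp (-((threshold ε ^ 2 - κ) * n)) := by gcongr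

lemma expRare_not_hasOGP {p : ℕ} {ε κ r ν₁ ν₂ : ℝ} (hε : ε ≤ 1) (hκ : 0 < κ)
    (hlevel : Real.log 2 + 3 * κ ≤ threshold ε ^ 2) (hr : 0 ≤ r) (hν₂ : r ≤ 1 - 2 * ν₂)
    (hpow : threshold ε ^ 2 * (1 - 2 * ν₁) ^ p ≤ κ)
    (hcap : ∀ (n : ℕ) (σ : Config n), ((cap r σ).card : ℝ) ≤ 2 * Real.exp (κ * n)) :
    ExpRare p fun _ => {J | ¬ HasOGP ν₁ ν₂ (superLevel J ε)} := by
  refine expRare_of_le_const_mul 2 hκ ?_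
  filter_upwards [eventually_ne_atTop 0] with n hn
  calc (disorder n p).real {J | ¬ HasOGP ν₁ ν₂ (superLevel J ε)}
      ≤ 2 ^ n * (2 * Real.exp (κ * n)) * Real.exp (-((threshold ε ^ 2 - κ) * n)) :=
        measureReal_not_hasOGP_le hn hε hκ.le hr hν₂ hpow (hcap n)
    _ ≤ 2 ^ n * (2 * Real.exp (κ * n)) * Real.exp (-((Real.log 2 + 2 * κ) * n)) := by
        gcongr
        linarith
    _ = 2 * Real.exp (-κ * n) := by
        rw [← Real.rpow_natCast, Real.rpow_def_of_pos two_pos, mul_left_comm, mul_assoc,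
          ← Real.exp_add, ← Real.exp_add]
        ring_nf

lemma exists_expRare_not_hasOGP {ε : ℝ} (hε : ε ≤ 1) (hlog : Real.log 2 < threshold ε ^ 2) :
    ∃ ν₂ : ℝ, 0 < ν₂ ∧ ν₂ < 1 ∧ ∀ ν₁, 0 < ν₁ → ν₁ < ν₂ → ∃ P : ℕ, ∀ p, P ≤ p →
      ExpRare p fun _ => {J | ¬ HasOGP ν₁ ν₂ (superLevel J ε)} := by
  have hκ : 0 < (threshold ε ^ 2 - Real.log 2) / 3 := by linarith
  obtain ⟨r, hr₀, hr₁, hcap⟩ := exists_card_cap_le_exp hκ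
  refine ⟨(1 - r) / 2, by linarith, by linarith, fun ν₁ hν₁ hν => ?_⟩
  obtain ⟨P, hP⟩ := exists_forall_mul_pow_sub_le (threshold ε ^ 2) (r := 1 - 2 * ν₁)
    (by linarith) (by linarith) hκ 0
  exact ⟨P, fun p hp => expRare_not_hasOGP hε hκ (by linarith) hr₀.le (by linarith) (hP p hp) hcap⟩

lemma log_two_lt_threshold_sq {ε : ℝ} (hε : ε < 1 - 1 / √2) : Real.log 2 < threshold ε ^ 2 := by
  have hhalf : 1 / 2 < (1 - ε) ^ 2 := by
    calc (1 / 2 : ℝ) = (1 / √2) ^ 2 := by rw [div_pow, Real.sq_sqrt zero_le_two, one_pow]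
      _ < (1 - ε) ^ 2 := by
        gcongr
        linarith
  rw [threshold_sq, rate]
  nlinarith [Real.log_pos one_lt_two]

lemma exists_card_cluster_le {c : ℝ} (hc : 0 < c) :
    ∃ ν : ℝ, 0 < ν ∧ ∀ ν₁ ν₂, ν₁ ≤ ν → ∀ᶠ n : ℕ in atTop, ∀ (A : Finset (Config n))
      (C : Finpartition A), IsClustering ν₁ ν₂ C →
        ∀ B ∈ C.parts, (B.card : ℝ) ≤ (2 : ℝ) ^ (c * n) := by
  have hclog : 0 < c * Real.log 2 := mul_pos hc (Real.log_pos one_lt_two)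
  obtain ⟨r, -, hr, hcap⟩ := exists_card_cap_le_exp (half_pos hclog)
  refine ⟨(1 - r) / 2, by linarith, fun ν₁ ν₂ hν => ?_⟩
  filter_upwards [eventually_const_mul_exp_le 2 (half_lt_self hclog), eventually_ne_atTop 0]
    with n hexp hn A C hC B hB
  obtain ⟨σ, hσ⟩ := C.nonempty_of_mem_parts hB
  calc (B.card : ℝ) ≤ (cap r σ).card := by
        exact_mod_cast Finset.card_le_card (hC.subset_cap hn (by linarith) hB hσ)
    _ ≤ 2 * Real.exp (c * Real.log 2 / 2 * n) := hcap n σ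
    _ ≤ (2 : ℝ) ^ (c * n) := by rwa [two_rpow_mul]

lemma shatters_of_expRare {p : ℕ} {ν₁ ν₂ c₁ c₂ : ℝ}
    {A : (n : ℕ) → Tensor n p → Finset (Config n)} (hν₁ : 0 ≤ ν₁) (hν : ν₁ < ν₂ / 2)
    (hOGP : ExpRare p fun n => {J | ¬ HasOGP ν₁ ν₂ (A n J)})
    (hcard : ExpRare p fun n => {J | ((A n J).card : ℝ) < (2 : ℝ) ^ (c₁ * n)})
    (hcluster : ∀ᶠ n : ℕ in atTop, ∀ (B : Finset (Config n)) (C : Finpartition B),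
      IsClustering ν₁ ν₂ C → ∀ c ∈ C.parts, (c.card : ℝ) ≤ (2 : ℝ) ^ (c₂ * n)) :
    Shatters p ν₁ ν₂ c₁ c₂ A := by
  refine ⟨hOGP.expLikely_compl, ((hOGP.union hcard).mono ?_).expLikely_compl⟩
  filter_upwards [hcluster, eventually_ne_atTop 0] with n hn hn₀ J hJ
  by_contra! hgood
  simp only [Set.mem_union, Set.mem_ofPred_eq, not_or, not_not, not_lt] at hgood
  refine hJ ⟨hgood.2, hgood.1.existsUnique_isClustering hn₀ hν₁ hν, fun C hC =>
    ⟨hn _ C hC, ?_⟩⟩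
  rw [sub_mul, Real.rpow_sub two_pos, div_le_iff₀ (by positivity)]
  exact hgood.2.trans (card_le_card_parts_mul C (hn _ C hC))

end OverlapGap

end PSpin

theorem mainTheorem2 (ε : ℝ) (hε : 0 < ε) (hε' : ε < 1 - 1 / Real.sqrt 2) :
    ∃ (P : ℕ) (ν₁ ν₂ c₁ c₂ : ℝ),
      0 < ν₁ ∧ ν₁ < ν₂ / 2 ∧ ν₂ / 2 < ν₂ ∧ ν₂ < 1 ∧ 0 < c₂ ∧ c₂ < c₁ ∧
      ∀ p : ℕ, P ≤ p →
        PSpin.Shatters p ν₁ ν₂ c₁ c₂ (fun _ J => PSpin.superLevel J ε) ∧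
        ∀ δ : ℝ, 0 < δ → δ < ε →
          PSpin.Shatters p ν₁ ν₂ c₁ c₂
            (fun _ J => PSpin.superLevel J ε \ PSpin.superLevel J δ) := by
  have hε₁ : ε < 1 := hε'.trans (sub_lt_self _ (by positivity))
  have hrate := PSpin.rate_pos hε hε₁
  obtain ⟨ν₂, hν₂, hν₂_lt, hgap⟩ :=
    PSpin.exists_expRare_not_hasOGP hε₁.le (PSpin.log_two_lt_threshold_sq hε')
  obtain ⟨ν, hν, hcluster⟩ := PSpin.exists_card_cluster_le (c := PSpin.rate ε / 4) (by positivity)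
  obtain ⟨ν₁, hν₁, hν₁min⟩ := exists_between (lt_min (half_pos hν₂) hν)
  obtain ⟨hν₁₂, hν₁ν⟩ := lt_min_iff.1 hν₁min
  obtain ⟨P, hOGP⟩ := hgap ν₁ hν₁ (by linarith)
  obtain ⟨P', hcard⟩ := PSpin.exists_expRare_card_superLevel_lt hε hε₁
  refine ⟨max P P', ν₁, ν₂, PSpin.rate ε / 2, PSpin.rate ε / 4, hν₁, hν₁₂, half_lt_self hν₂, hν₂_lt,
    by positivity, by linarith, fun p hp => ?_⟩
  have hOGP' := hOGP p (le_of_max_le_left hp)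
  have hcard' := hcard p (le_of_max_le_right hp)
  have hcluster' := hcluster ν₁ ν₂ hν₁ν.le
  refine ⟨PSpin.shatters_of_expRare hν₁.le hν₁₂ hOGP' (hcard' _ (half_lt_self hrate)) hcluster',
    fun δ _ hδ => PSpin.shatters_of_expRare hν₁.le hν₁₂ ?_ ?_ hcluster'⟩
  · exact hOGP'.mono (.of_forall fun n J hJ h => hJ (h.mono Finset.sdiff_subset))
  · exact PSpin.expRare_card_superLevel_sdiff_lt hε₁.le hδ (half_lt_self hrate) hcard'
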